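/- Let $0<T\le\infty$ and let $X:S^1\times[0,T)\to\mathbb{R}^2$ ($S^1=\mathbb{R}/2\pi\mathbb{Z}$) be a smooth family of regular closed plane curves with nowhere vanishing curvature which evolves by $$\frac{\partial X}{\partial t}=\eta\,\mathbf{T}+\Big(\kappa-\frac{\lambda(t)}{\kappa}\Big)N,\qquad \lambda(t)=\frac{2\pi}{\oint\frac1\kappa\,ds},$$ where $\mathbf{T}$ is the unit tangent, $N$ the unit normal to its left, $\kappa$ the curvature with respect to $N$, $s$ arc length, and the tangential speed $\eta=\eta(u,t)$ is arbitrary (it affects only the parametrization; $\eta=0$ is the flow in normal direction). Suppose that the initial curve $X(\cdot,0)$ is a simple, counterclockwise, strictly convex closed curve (it lies to the left of each of its tangent lines, and $\kappa>0$). Let $L(t)=\oint ds$ and $A(t)=\frac12\oint x\,dy-y\,dx$ be the length of and the area enclosed by $X(\cdot,t)$. Then $A(0)>0$, and: 1. The isoperimetric deficit $L^2-4\pi A$ is nonnegative and nonincreasing on $[0,T)$, and strictly decreasing as long as it is positive: if $s<t$ and $L(s)^2-4\pi A(s)>0$, then $L(t)^2-4\pi A(t)<L(s)^2-4\pi A(s)$.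 2. It decays exponentially: for all $t\in[0,T)$, $$L(t)^2-4\pi A(t)\le\big(L(0)^2-4\pi A(0)\big)\,e^{-2\pi t/A(0)};$$ in particular, if $L(0)\ge\frac12$, then $L(t)^2-4\pi A(t)\le\big(L(0)^2-4\pi A(0)\big)\,e^{-\pi t/(A(0)L(0))}$ for all $t\in[0,T)$. 3. If no singularities form, i.e. if $T=\infty$, then $L(t)^2-4\pi A(t)\to0$ as $t\to\infty$, and there is a point $c\in\mathbb{R}^2$ such that the curves $X(S^1,t)$ converge in the Hausdorff metric, as $t\to\infty$, to the circle of radius $\sqrt{A(0)/\pi}$ centred at $c$. -/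

import Mathlib

open Set Filter Topology MeasureTheory
open scoped ContDiff

noncomputable section

namespace CurveFlow

/-- The Euclidean plane. -/
abbrev Plane : Type := EuclideanSpace ℝ (Fin 2)

/-- Counterclockwise rotation of the plane by a right angle. -/
def rot (v : Plane) : Plane := !₂[-v 1, v 0]

/-! Geometry of a closed plane curve, given as a `2π`-periodic map `γ : ℝ → Plane`,
that is, a map on the circle `ℝ / 2πℤ`. -/

/-- The metric `g = |γ_u|`, so that `ds = g du`. -/
def metric (γ : ℝ → Plane) (u : ℝ) : ℝ := ‖deriv γ u‖

/-- The unit tangent vector `T = (1 / g) γ_u`. -/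
def tangent (γ : ℝ → Plane) (u : ℝ) : Plane := (metric γ u)⁻¹ • deriv γ u

/-- The unit normal vector, to the left of `T`. It is the inward normal of a counterclockwise
convex curve, and equals `(1 / κ) T_s` where `κ ≠ 0`. -/
def normal (γ : ℝ → Plane) (u : ℝ) : Plane := rot (tangent γ u)

/-- The signed curvature: `T_s = κ N` with `T_s = (1 / g) T_u`, so `κ = ⟨T_s, N⟩`, which is the
arc-length derivative of the direction angle of `T`. -/
def curvature (γ : ℝ → Plane) (u : ℝ) : ℝ :=
  inner ℝ ((metric γ u)⁻¹ • deriv (tangent γ) u) (normal γ u)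

/-- The length `L = ∮ ds`. -/
def length (γ : ℝ → Plane) : ℝ := ∫ u in (0 : ℝ)..(2 * Real.pi), metric γ u

/-- The enclosed (algebraic) area `A = ½ ∮ x dy - y dx`. -/
def area (γ : ℝ → Plane) : ℝ :=
  1 / 2 * ∫ u in (0 : ℝ)..(2 * Real.pi), (γ u 0 * deriv γ u 1 - γ u 1 * deriv γ u 0)

/-- The isoperimetric deficit `L² - 4πA`. -/
def deficit (γ : ℝ → Plane) : ℝ := length γ ^ 2 - 4 * Real.pi * area γ

/-- The nonlocal term `λ = 2π / ∮ (1 / κ) ds`. -/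
def nonlocalTerm (γ : ℝ → Plane) : ℝ :=
  2 * Real.pi / ∫ u in (0 : ℝ)..(2 * Real.pi), 1 / curvature γ u * metric γ u

/-- A smooth regular simple closed curve, counterclockwise, which is convex (it lies on the left
of each of its tangent lines) and whose curvature is positive. -/
structure IsStrictlyConvexClosed (γ : ℝ → Plane) : Prop where
  smooth : ContDiff ℝ ∞ γ
  periodic : Function.Periodic γ (2 * Real.pi)
  regular : ∀ u, deriv γ u ≠ 0
  simple : InjOn γ (Ico 0 (2 * Real.pi))
  convex : ∀ u v, 0 ≤ inner ℝ (γ v - γ u) (normal γ u)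
  curvature_pos : ∀ u, 0 < curvature γ u

/-- The time interval `[0, T)`, where `T = ⊤` is allowed. -/
def timeInterval (T : EReal) : Set ℝ := {t : ℝ | 0 ≤ t ∧ (t : EReal) < T}

/-- `X : S¹ × [0, T) → ℝ²` is a smooth family of regular closed curves that solves
`X_t = η T + (κ - λ / κ) N` with `λ = 2π / ∮ (1 / κ) ds`. The tangential speed `η` is arbitrary, as
it only affects the parametrization: `η = 0` is the flow in the normal direction, and another choice
keeps the direction angle independent of time. The curvature does not vanish, since the equation
contains `1 / κ`. -/
structure IsFlow (T : EReal) (X : ℝ → ℝ → Plane) : Prop where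
  smooth : ContDiffOn ℝ ∞ (fun p : ℝ × ℝ => X p.1 p.2) (univ ×ˢ timeInterval T)
  periodic : ∀ t ∈ timeInterval T, Function.Periodic (fun u => X u t) (2 * Real.pi)
  regular : ∀ t ∈ timeInterval T, ∀ u, deriv (fun v => X v t) u ≠ 0
  curvature_ne_zero : ∀ t ∈ timeInterval T, ∀ u, curvature (fun v => X v t) u ≠ 0
  evolution : ∃ η : ℝ → ℝ → ℝ, ∀ t ∈ timeInterval T, ∀ u,
    HasDerivWithinAt (fun τ => X u τ)
      (η u t • tangent (fun v => X v t) u +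
        (curvature (fun v => X v t) u
            - nonlocalTerm (fun v => X v t) / curvature (fun v => X v t) u) •
          normal (fun v => X v t) u)
      (timeInterval T) t

end CurveFlow

end

namespace CurveFlow

/-! ### A Dirichlet–Wirtinger inequality in a reparametrized angle -/

/-! With normal speed `F = κ - λ/κ`, the first variation formulas give `A' = -∮ F ds = -2π + λ ∮ κ⁻¹
ds = 0` and `L' = -∮ κ F ds = λ L - ∮ κ² ds`. Two sharp inequalities for closed convex curves
control `L'`: Gage's `∮ κ² ds ≥ π L / A` and the Green–Osher inequality `∮ κ⁻¹ ds ≥ (L² - 2πA) / π`,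
which bounds `λ` from above. Together they yield `(L²)' ≤ -(2π/A) (L² - 4πA)`, so `exp(2πt/A) (L² -
4πA)` is nonincreasing; this is the whole of the decay statement.

Both inequalities come from one Bonnesen estimate. Some chord with antiparallel end tangents bisects
the area. With its midpoint as origin, the support function `h` and the tangential component `q =
dh/dθ` take equal values at the two ends of each half. If `c` is a point of the half, `h - h(c)`
vanishes there, and the Wirtinger type inequality `integral_sq_le_integral_deriv_sq` becomes `S - 2
h(c) l + π h(c)² ≤ 0`, where `l = ∫ ds` and `S = ∫ h ds = A` over the half. Integrating this in `c`
against `ds` leads to Gage's inequality, and against `dθ` to that of Green and Osher. Its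
discriminant gives the isoperimetric inequality, and its roots show that `|h - √(A/π)|` is at most
the square root of the deficit.

Every time slice is covered: `κ` cannot change sign because it never vanishes, and the total turning
is constant in time, hence equal to its initial value `2π`, which is where simplicity and convexity
of the initial curve enter.

For convergence the bisecting midpoints may jump, so they are replaced by the Steiner point, which
lies close to any point for which `h` is almost constant. Its velocity is an integral of `κ² - λ`
against a component of the tangent. These components are orthogonal to `ds` and `κ ds`, so `κ² - λ`
may be replaced by `(κ - 2π/L)²`, and the integral defining the velocity is at most `-L'`. Since `L`
converges, so does the Steiner point, and its limit is the centre of the limit circle. -/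

lemma continuousAt_sq_mul_cot {f δ : ℝ → ℝ} {f' δ' u : ℝ} (hf : HasDerivAt f f' u)
    (hδ : HasDerivAt δ δ' u) (hδ' : δ' ≠ 0) (hfu : Real.sin (δ u) = 0 → f u = 0) :
    ContinuousAt (fun v => f v ^ 2 * Real.cos (δ v) / Real.sin (δ v)) u := by
  have hcos : ContinuousAt (fun v => Real.cos (δ v)) u :=
    Real.continuous_cos.continuousAt.comp hδ.continuousAt
  have hsin : ContinuousAt (fun v => Real.sin (δ v)) u :=
    Real.continuous_sin.continuousAt.comp hδ.continuousAt
  by_cases hs : Real.sin (δ u) = 0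
  · have hf0 := hfu hs
    have hc : Real.cos (δ u) ≠ 0 := by
      intro h
      have := Real.sin_sq_add_cos_sq (δ u)
      rw [hs, h] at this
      norm_num at this
    -- At a zero of the sine the quotient has the value `0`, as division by zero gives `0`. Near
    -- that zero it equals `f cos δ` times a ratio of slopes of `f` and `sin δ`; the ratio has a
    -- finite limit and `f` tends to `0`.
    rw [continuousAt_iff_punctured_nhds]
    have h1 := (hasDerivAt_iff_tendsto_slope.1 hf)
    have h2 := (hasDerivAt_iff_tendsto_slope.1 hδ.sin)
    have h3 : Tendsto (fun v => f v * Real.cos (δ v) * (slope f u v /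
        slope (fun v => Real.sin (δ v)) u v)) (𝓝[≠] u)
        (𝓝 (f u * Real.cos (δ u) * (f' / (Real.cos (δ u) * δ')))) :=
      ((hf.continuousAt.mul hcos).tendsto.mono_left nhdsWithin_le_nhds).mul
        (h1.div h2 (mul_ne_zero hc hδ'))
    simp only [hf0, hs, zero_mul, div_zero] at h3 ⊢
    refine h3.congr' ?_
    filter_upwards [self_mem_nhdsWithin] with v hv
    have hv' : v - u ≠ 0 := sub_ne_zero.2 hv
    simp only [slope_def_field, hf0, hs, sub_zero]
    rw [div_div_div_cancel_right₀ hv']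
    ring
  · exact ((hf.continuousAt.pow 2).mul hcos).div hsin hs

/-- If `θ' = w > 0`, `θ` increases by `π` on `[α, β]`, `f' = w q`, and `f` has equal values at the
end points and a zero in between, then `∫ f² dθ ≤ ∫ (df/dθ)² dθ`. -/
theorem integral_sq_le_integral_deriv_sq {θ w f q : ℝ → ℝ} {α β c : ℝ}
    (hθ : ∀ u, HasDerivAt θ (w u) u) (hw : ∀ u, 0 < w u) (hf : ∀ u, HasDerivAt f (w u * q u) u)
    (hwc : Continuous w) (hq : Continuous q) (hαβ : θ β = θ α + Real.pi) (hends : f α = f β)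
    (hc : c ∈ Icc α β) (hfc : f c = 0) :
    ∫ u in α..β, f u ^ 2 * w u ≤ ∫ u in α..β, q u ^ 2 * w u := by
  have hmono : StrictMono θ := strictMono_of_hasDerivAt_pos hθ hw
  have hfcont : Continuous f := continuous_iff_continuousAt.2 fun u => (hf u).continuousAt
  -- The identity behind the proof is `(q² - f²) dθ = d(f² cot(θ - θ c)) + (q - f cot(θ - θ c))²
  -- dθ`. Hence `G` below is nondecreasing on both sides of `c`, and `K` has equal end values
  -- because the cotangent has period `π`.
  set K : ℝ → ℝ := fun v => f v ^ 2 * Real.cos (θ v - θ c) / Real.sin (θ v - θ c) with hK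
  have hint : Continuous fun u => (q u ^ 2 - f u ^ 2) * w u := by fun_prop
  set G : ℝ → ℝ := fun v => (∫ u in α..v, (q u ^ 2 - f u ^ 2) * w u) - K v with hG
  have hsin_ne : ∀ v ∈ Ioo α β, v ≠ c → Real.sin (θ v - θ c) ≠ 0 := by
    intro v hv hvc
    have h1 := hmono hv.1
    have h2 := hmono hv.2
    have h3 := hmono.monotone hc.1
    have h4 := hmono.monotone hc.2
    rcases lt_or_gt_of_ne hvc with h | h
    · have := hmono h
      exact (Real.sin_neg_of_neg_of_neg_pi_lt (by linarith) (by linarith)).ne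
    · have := hmono h
      exact (Real.sin_pos_of_pos_of_lt_pi (by linarith) (by linarith)).ne'
  -- The difference `θ v - θ c` lies in `[-π, π]`, so the sine vanishes only for `v = c` or when `v`
  -- and `c` are the two end points. In the latter case `f v = f c` by the equality of the end
  -- values.
  have hend : ∀ v ∈ Icc α β, Real.sin (θ v - θ c) = 0 → f v = 0 := by
    intro v hv hs
    have h3 := hmono.monotone hc.1
    have h4 := hmono.monotone hc.2
    have key : ∀ u u', u ≤ u' → θ u' ≤ θ u + Real.pi → Real.sin (θ u' - θ u) = 0 →
        u = u' ∨ θ u' = θ u + Real.pi := by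
      intro u u' huu h5 h6
      rcases huu.eq_or_lt with h | h
      · exact Or.inl h
      · rcases h5.eq_or_lt with h7 | h7
        · exact Or.inr h7
        · have := hmono h
          exact absurd h6 (Real.sin_pos_of_pos_of_lt_pi (by linarith) (by linarith)).ne'
    have h1 := hmono.monotone hv.1
    have h2 := hmono.monotone hv.2
    rcases le_total v c with h | h
    · rcases key v c h (by linarith) (by rw [← neg_sub, Real.sin_neg, hs, neg_zero]) with h' | h'
      · rw [h', hfc]
      · have e1 : θ c = θ β := by linarith
        have e2 : θ v = θ α := by linarith
        rw [hmono.injective e2, hends, ← hmono.injective e1, hfc]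
    · rcases key c v h (by linarith) hs with h' | h'
      · rw [← h', hfc]
      · have e1 : θ v = θ β := by linarith
        have e2 : θ c = θ α := by linarith
        rw [hmono.injective e1, ← hends, ← hmono.injective e2, hfc]
  have hGcont : ContinuousOn G (Icc α β) := by
    intro v hv
    refine ContinuousAt.continuousWithinAt (ContinuousAt.sub ?_ ?_)
    · exact (intervalIntegral.continuous_primitive (fun a b => hint.intervalIntegrable a b)
        α).continuousAt
    · exact continuousAt_sq_mul_cot (hf v) ((hθ v).sub_const (θ c)) (hw v).ne' (hend v hv)
  have hGderiv : ∀ v ∈ Ioo α β, v ≠ c → HasDerivAt G ((q v - f v * Real.cos (θ v - θ c) /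
      Real.sin (θ v - θ c)) ^ 2 * w v) v := by
    intro v hv hvc
    have hs := hsin_ne v hv hvc
    have h1 : HasDerivAt (fun v => ∫ u in α..v, (q u ^ 2 - f u ^ 2) * w u)
        ((q v ^ 2 - f v ^ 2) * w v) v :=
      intervalIntegral.integral_hasDerivAt_right (hint.intervalIntegrable _ _)
        (hint.stronglyMeasurableAtFilter _ _) hint.continuousAt
    have hδ := (hθ v).sub_const (θ c)
    have h2 := (((hf v).pow 2).mul hδ.cos).div hδ.sin hs
    refine (h1.sub h2).congr_deriv ?_
    simp only [Pi.mul_apply, Pi.pow_apply]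
    field_simp
    push_cast
    ring
  have h1 : G α ≤ G c := by
    refine monotoneOn_of_deriv_nonneg (convex_Icc α c)
      (hGcont.mono (Icc_subset_Icc_right hc.2)) ?_ ?_ (left_mem_Icc.2 hc.1)
      (right_mem_Icc.2 hc.1) hc.1 <;> rw [interior_Icc] <;> intro v hv
    · exact (hGderiv v ⟨hv.1, hv.2.trans_le hc.2⟩ hv.2.ne).differentiableAt.differentiableWithinAt
    · rw [(hGderiv v ⟨hv.1, hv.2.trans_le hc.2⟩ hv.2.ne).deriv]
      exact mul_nonneg (sq_nonneg _) (hw v).le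
  have h2 : G c ≤ G β := by
    refine monotoneOn_of_deriv_nonneg (convex_Icc c β)
      (hGcont.mono (Icc_subset_Icc_left hc.1)) ?_ ?_ (left_mem_Icc.2 hc.2)
      (right_mem_Icc.2 hc.2) hc.2 <;> rw [interior_Icc] <;> intro v hv
    · exact (hGderiv v ⟨hc.1.trans_lt hv.1, hv.2⟩ hv.1.ne').differentiableAt.differentiableWithinAt
    · rw [(hGderiv v ⟨hc.1.trans_lt hv.1, hv.2⟩ hv.1.ne').deriv]
      exact mul_nonneg (sq_nonneg _) (hw v).le
  have hKend : K α = K β := by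
    simp only [hK, hαβ, hends]
    rw [show θ α + Real.pi - θ c = θ α - θ c + Real.pi by ring, Real.sin_add_pi, Real.cos_add_pi,
      mul_neg, neg_div_neg_eq]
  have h3 := h1.trans h2
  simp only [hG, intervalIntegral.integral_same, hKend] at h3
  have h4 : ∫ u in α..β, (q u ^ 2 - f u ^ 2) * w u =
      (∫ u in α..β, q u ^ 2 * w u) - ∫ u in α..β, f u ^ 2 * w u := by
    rw [← intervalIntegral.integral_sub]
    · simp only [sub_mul]
    · exact Continuous.intervalIntegrable (by fun_prop) _ _
    · exact Continuous.intervalIntegrable (by fun_prop) _ _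
  linarith

end CurveFlow

namespace CurveFlow

/-! ### Closed curves with a moving frame -/

/-- A closed curve `(x, y)` with unit tangent `(a, b)`, speed `g`, and derivative `w > 0` of the
direction angle, which makes one full turn. -/
structure ConvexFrame (x y a b g w : ℝ → ℝ) : Prop where
  deriv_x : ∀ u, HasDerivAt x (g u * a u) u
  deriv_y : ∀ u, HasDerivAt y (g u * b u) u
  deriv_a : ∀ u, HasDerivAt a (-(w u * b u)) u
  deriv_b : ∀ u, HasDerivAt b (w u * a u) u
  unit : ∀ u, a u ^ 2 + b u ^ 2 = 1
  g_pos : ∀ u, 0 < g u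
  w_pos : ∀ u, 0 < w u
  g_cont : Continuous g
  w_cont : Continuous w
  x_per : Function.Periodic x (2 * Real.pi)
  y_per : Function.Periodic y (2 * Real.pi)
  a_per : Function.Periodic a (2 * Real.pi)
  b_per : Function.Periodic b (2 * Real.pi)
  g_per : Function.Periodic g (2 * Real.pi)
  w_per : Function.Periodic w (2 * Real.pi)
  total : ∫ u in (0 : ℝ)..(2 * Real.pi), w u = 2 * Real.pi

/-- The direction angle, normalized to vanish at `0`. -/
noncomputable def angle (w : ℝ → ℝ) (u : ℝ) : ℝ := ∫ v in (0 : ℝ)..u, w v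

/-- The support function with respect to the point `(p, r)`. -/
def support (x y a b : ℝ → ℝ) (p r u : ℝ) : ℝ := (x u - p) * b u - (y u - r) * a u

/-- The tangential component of the position relative to the point `(p, r)`. -/
def tangential (x y a b : ℝ → ℝ) (p r u : ℝ) : ℝ := (x u - p) * a u + (y u - r) * b u

lemma hasDerivAt_angle {w : ℝ → ℝ} (hw : Continuous w) (u : ℝ) : HasDerivAt (angle w) (w u) u :=
  intervalIntegral.integral_hasDerivAt_right (hw.intervalIntegrable _ _)
    (hw.stronglyMeasurableAtFilter _ _) hw.continuousAt

/-- The tangent turns by the angle. -/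
lemma rotation_of_angle {a b w : ℝ → ℝ} (ha : ∀ u, HasDerivAt a (-(w u * b u)) u)
    (hb : ∀ u, HasDerivAt b (w u * a u) u) (hw : Continuous w) (u : ℝ) :
    a u = a 0 * Real.cos (angle w u) - b 0 * Real.sin (angle w u) ∧
      b u = b 0 * Real.cos (angle w u) + a 0 * Real.sin (angle w u) := by
  have hθ := hasDerivAt_angle hw
  have h0 : angle w 0 = 0 := intervalIntegral.integral_same
  have h1 : a u * Real.cos (angle w u) + b u * Real.sin (angle w u) = a 0 := by
    have h : ∀ u, HasDerivAt (fun u => a u * Real.cos (angle w u) + b u * Real.sin (angle w u))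
        0 u := fun u =>
      (((ha u).mul (hθ u).cos).add ((hb u).mul (hθ u).sin)).congr_deriv (by ring)
    have := is_const_of_deriv_eq_zero (fun u => (h u).differentiableAt) (fun u => (h u).deriv) u 0
    simpa [h0] using this
  have h2 : b u * Real.cos (angle w u) - a u * Real.sin (angle w u) = b 0 := by
    have h : ∀ u, HasDerivAt (fun u => b u * Real.cos (angle w u) - a u * Real.sin (angle w u))
        0 u := fun u =>
      (((hb u).mul (hθ u).cos).sub ((ha u).mul (hθ u).sin)).congr_deriv (by ring)
    have := is_const_of_deriv_eq_zero (fun u => (h u).differentiableAt) (fun u => (h u).deriv) u 0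
    simpa [h0] using this
  have h3 := Real.sin_sq_add_cos_sq (angle w u)
  rw [← h1, ← h2]
  constructor
  · linear_combination (-(a u)) * h3
  · linear_combination (-(b u)) * h3

namespace ConvexFrame

variable {x y a b g w : ℝ → ℝ}

lemma x_cont (H : ConvexFrame x y a b g w) : Continuous x :=
  continuous_iff_continuousAt.2 fun u => (H.deriv_x u).continuousAt

lemma y_cont (H : ConvexFrame x y a b g w) : Continuous y :=
  continuous_iff_continuousAt.2 fun u => (H.deriv_y u).continuousAt

lemma a_cont (H : ConvexFrame x y a b g w) : Continuous a :=
  continuous_iff_continuousAt.2 fun u => (H.deriv_a u).continuousAt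

lemma b_cont (H : ConvexFrame x y a b g w) : Continuous b :=
  continuous_iff_continuousAt.2 fun u => (H.deriv_b u).continuousAt

lemma support_cont (H : ConvexFrame x y a b g w) (p r : ℝ) :
    Continuous (support x y a b p r) :=
  ((H.x_cont.sub continuous_const).mul H.b_cont).sub
    ((H.y_cont.sub continuous_const).mul H.a_cont)

lemma tangential_cont (H : ConvexFrame x y a b g w) (p r : ℝ) :
    Continuous (tangential x y a b p r) :=
  ((H.x_cont.sub continuous_const).mul H.a_cont).add
    ((H.y_cont.sub continuous_const).mul H.b_cont)

lemma support_per (H : ConvexFrame x y a b g w) (p r : ℝ) :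
    Function.Periodic (support x y a b p r) (2 * Real.pi) := fun u => by
  simp only [support, H.x_per u, H.y_per u, H.a_per u, H.b_per u]

lemma deriv_support (H : ConvexFrame x y a b g w) (p r u : ℝ) :
    HasDerivAt (support x y a b p r) (w u * tangential x y a b p r u) u := by
  refine ((((H.deriv_x u).sub_const p).mul (H.deriv_b u)).sub
    (((H.deriv_y u).sub_const r).mul (H.deriv_a u))).congr_deriv ?_
  simp only [tangential]
  ring

lemma deriv_tangential (H : ConvexFrame x y a b g w) (p r u : ℝ) :
    HasDerivAt (tangential x y a b p r) (g u - w u * support x y a b p r u) u := by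
  refine ((((H.deriv_x u).sub_const p).mul (H.deriv_a u)).add
    (((H.deriv_y u).sub_const r).mul (H.deriv_b u))).congr_deriv ?_
  simp only [support]
  linear_combination (g u) * H.unit u

lemma deriv_angle (H : ConvexFrame x y a b g w) (u : ℝ) : HasDerivAt (angle w) (w u) u :=
  hasDerivAt_angle H.w_cont u

lemma angle_strictMono (H : ConvexFrame x y a b g w) : StrictMono (angle w) :=
  strictMono_of_hasDerivAt_pos H.deriv_angle H.w_pos

lemma angle_cont (H : ConvexFrame x y a b g w) : Continuous (angle w) :=
  continuous_iff_continuousAt.2 fun u => (H.deriv_angle u).continuousAt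

lemma angle_sub (H : ConvexFrame x y a b g w) (u v : ℝ) :
    ∫ s in u..v, w s = angle w v - angle w u :=
  (intervalIntegral.integral_interval_sub_left (H.w_cont.intervalIntegrable _ _)
    (H.w_cont.intervalIntegrable _ _)).symm

lemma angle_add_period (H : ConvexFrame x y a b g w) (u : ℝ) :
    angle w (u + 2 * Real.pi) = angle w u + 2 * Real.pi := by
  have h1 := H.angle_sub u (u + 2 * Real.pi)
  have h2 := H.w_per.intervalIntegral_add_eq u 0
  rw [zero_add, H.total] at h2
  linarith

/-- The angle gains `2π` over each period, so it is unbounded in both directions, and it is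
continuous. -/
lemma angle_surjective (H : ConvexFrame x y a b g w) : Function.Surjective (angle w) := by
  have hn : ∀ n : ℕ, ∀ u, angle w (u + n * (2 * Real.pi)) = angle w u + n * (2 * Real.pi) := by
    intro n
    induction n with
    | zero => simp
    | succ k ih =>
      intro u
      push_cast
      rw [show u + (k + 1) * (2 * Real.pi) = (u + k * (2 * Real.pi)) + 2 * Real.pi by ring,
        H.angle_add_period, ih]
      ring
  intro t
  obtain ⟨n, hn'⟩ := exists_nat_gt (|t| / (2 * Real.pi))
  rw [div_lt_iff₀ Real.two_pi_pos] at hn'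
  have h0 : angle w 0 = 0 := intervalIntegral.integral_same
  have h1 := hn n 0
  have h2 := hn n (-(n * (2 * Real.pi)))
  rw [neg_add_cancel, h0] at h2
  simp only [h0, zero_add] at h1
  have := intermediate_value_univ (-(n * (2 * Real.pi))) (n * (2 * Real.pi)) H.angle_cont
  refine this ⟨?_, ?_⟩
  · have := neg_abs_le t
    linarith
  · have := le_abs_self t
    linarith

lemma neg_of_angle_add_pi (H : ConvexFrame x y a b g w) {u v : ℝ}
    (h : angle w v = angle w u + Real.pi) : a v = -a u ∧ b v = -b u := by
  obtain ⟨h1, h2⟩ := rotation_of_angle H.deriv_a H.deriv_b H.w_cont u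
  obtain ⟨h3, h4⟩ := rotation_of_angle H.deriv_a H.deriv_b H.w_cont v
  rw [h3, h4, h1, h2, h, Real.cos_add_pi, Real.sin_add_pi]
  constructor <;> ring

end ConvexFrame

end CurveFlow

namespace CurveFlow

namespace ConvexFrame

variable {x y a b g w : ℝ → ℝ}

/-! ### Inequalities on an arc along which the tangent turns by `π` -/

section HalfTurn

variable {p r α β : ℝ}

lemma lt_of_angle_add_pi (H : ConvexFrame x y a b g w)
    (hαβ : angle w β = angle w α + Real.pi) : α < β :=
  H.angle_strictMono.lt_iff_lt.1 (by linarith [Real.pi_pos])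

/-- Integration of `dq = ds - h dθ` between points with the same `q`. -/
lemma half_integral_speed (H : ConvexFrame x y a b g w)
    (hq : tangential x y a b p r α = tangential x y a b p r β) :
    ∫ u in α..β, support x y a b p r u * w u = ∫ u in α..β, g u := by
  have hg := H.g_cont
  have hw := H.w_cont
  have hs := H.support_cont p r
  have h := intervalIntegral.integral_eq_sub_of_hasDerivAt (a := α) (b := β)
    (fun u _ => H.deriv_tangential p r u) (Continuous.intervalIntegrable (by fun_prop) _ _)
  rw [intervalIntegral.integral_sub (hg.intervalIntegrable _ _)
    (Continuous.intervalIntegrable (by fun_prop) _ _), ← hq, sub_self] at h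
  simp only [mul_comm _ (w _)]
  linarith

/-- Integration of `d(h q) = q² dθ + h ds - h² dθ`, whose boundary terms cancel. -/
lemma half_integral_support_speed (H : ConvexFrame x y a b g w)
    (hh : support x y a b p r α = support x y a b p r β)
    (hq : tangential x y a b p r α = tangential x y a b p r β) :
    (∫ u in α..β, support x y a b p r u ^ 2 * w u) -
      ∫ u in α..β, tangential x y a b p r u ^ 2 * w u = ∫ u in α..β, support x y a b p r u * g u := by
  have hg := H.g_cont
  have hw := H.w_cont
  have hs := H.support_cont p r
  have ht := H.tangential_cont p r
  have h := intervalIntegral.integral_eq_sub_of_hasDerivAt (a := α) (b := β)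
    (fun u _ => (H.deriv_support p r u).mul (H.deriv_tangential p r u))
    (Continuous.intervalIntegrable (by fun_prop) _ _)
  simp only [Pi.mul_apply] at h
  rw [← hq, ← hh, sub_self] at h
  rw [← intervalIntegral.integral_sub (Continuous.intervalIntegrable (by fun_prop) _ _)
    (Continuous.intervalIntegrable (by fun_prop) _ _), ← sub_eq_zero,
    ← intervalIntegral.integral_sub (Continuous.intervalIntegrable (by fun_prop) _ _)
    (Continuous.intervalIntegrable (by fun_prop) _ _), ← neg_eq_zero,
    ← intervalIntegral.integral_neg, ← h]
  congr 1
  ext u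
  ring

/-- The Bonnesen inequality for the values of the support function. -/
lemma half_bonnesen (H : ConvexFrame x y a b g w)
    (hαβ : angle w β = angle w α + Real.pi)
    (hh : support x y a b p r α = support x y a b p r β)
    (hq : tangential x y a b p r α = tangential x y a b p r β) {c : ℝ} (hc : c ∈ Icc α β) :
    (∫ u in α..β, support x y a b p r u * g u) -
      2 * support x y a b p r c * (∫ u in α..β, g u) +
      Real.pi * support x y a b p r c ^ 2 ≤ 0 := by
  have hw := H.w_cont
  have hs := H.support_cont p r
  set k := support x y a b p r c
  -- The function `h - h(c)` vanishes at `c`, has equal end values and `θ`-derivative `q`. Expanding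
  -- the square and eliminating `∫ h² dθ - ∫ q² dθ = ∫ h ds` leaves the claim.
  have h1 := integral_sq_le_integral_deriv_sq (f := fun u => support x y a b p r u - k)
    H.deriv_angle H.w_pos (fun u => (H.deriv_support p r u).sub_const k) hw
    (H.tangential_cont p r) hαβ (by simp only [hh]) hc (sub_self _)
  have h2 := H.half_integral_support_speed hh hq
  have h3 := H.half_integral_speed hq
  have h4 : ∫ u in α..β, w u = Real.pi := by rw [H.angle_sub]; linarith
  have h5 : ∫ u in α..β, (support x y a b p r u - k) ^ 2 * w u =
      (∫ u in α..β, support x y a b p r u ^ 2 * w u) -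
      2 * k * (∫ u in α..β, support x y a b p r u * w u) + k ^ 2 * ∫ u in α..β, w u := by
    rw [← intervalIntegral.integral_const_mul, ← intervalIntegral.integral_const_mul,
      ← intervalIntegral.integral_sub (Continuous.intervalIntegrable (by fun_prop) _ _)
      (Continuous.intervalIntegrable (by fun_prop) _ _),
      ← intervalIntegral.integral_add (Continuous.intervalIntegrable (by fun_prop) _ _)
      (Continuous.intervalIntegrable (by fun_prop) _ _)]
    congr 1
    ext u
    ring
  rw [h3, h4] at h5
  linarith

/-- The Bonnesen inequality holds at every point of the arc and may therefore be integrated against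
`ds`. -/
lemma half_gage (H : ConvexFrame x y a b g w)
    (hαβ : angle w β = angle w α + Real.pi)
    (hh : support x y a b p r α = support x y a b p r β)
    (hq : tangential x y a b p r α = tangential x y a b p r β) :
    Real.pi * (∫ u in α..β, support x y a b p r u ^ 2 * g u) ≤
      (∫ u in α..β, support x y a b p r u * g u) * ∫ u in α..β, g u := by
  have hg := H.g_cont
  have hs := H.support_cont p r
  set S := ∫ u in α..β, support x y a b p r u * g u
  set l := ∫ u in α..β, g u
  have h1 : 0 ≤ ∫ u in α..β, (2 * support x y a b p r u * l - S -
      Real.pi * support x y a b p r u ^ 2) * g u := by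
    refine intervalIntegral.integral_nonneg (H.lt_of_angle_add_pi hαβ).le fun u hu => ?_
    have := H.half_bonnesen hαβ hh hq hu
    exact mul_nonneg (by linarith) (H.g_pos u).le
  have h2 : ∀ l S : ℝ, ∫ u in α..β, (2 * support x y a b p r u * l - S -
      Real.pi * support x y a b p r u ^ 2) * g u =
      2 * l * (∫ u in α..β, support x y a b p r u * g u) - S * (∫ u in α..β, g u) -
      Real.pi * ∫ u in α..β, support x y a b p r u ^ 2 * g u := by
    intro l S
    rw [← intervalIntegral.integral_const_mul, ← intervalIntegral.integral_const_mul,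
      ← intervalIntegral.integral_const_mul,
      ← intervalIntegral.integral_sub (Continuous.intervalIntegrable (by fun_prop) _ _)
      (Continuous.intervalIntegrable (by fun_prop) _ _),
      ← intervalIntegral.integral_sub (Continuous.intervalIntegrable (by fun_prop) _ _)
      (Continuous.intervalIntegrable (by fun_prop) _ _)]
    congr 1
    ext u
    ring
  linarith [h2 l S]

/-- The same inequality integrated against `dθ`, with `∫ h dθ = l` and `∫ dθ = π`. -/
lemma half_integral_support_sq (H : ConvexFrame x y a b g w)
    (hαβ : angle w β = angle w α + Real.pi)
    (hh : support x y a b p r α = support x y a b p r β)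
    (hq : tangential x y a b p r α = tangential x y a b p r β) :
    Real.pi * (∫ u in α..β, support x y a b p r u ^ 2 * w u) ≤
      2 * (∫ u in α..β, g u) ^ 2 - Real.pi * ∫ u in α..β, support x y a b p r u * g u := by
  have hw := H.w_cont
  have hs := H.support_cont p r
  have h3 := H.half_integral_speed hq
  have h4 : ∫ u in α..β, w u = Real.pi := by rw [H.angle_sub]; linarith
  set S := ∫ u in α..β, support x y a b p r u * g u
  set l := ∫ u in α..β, g u
  have h1 : 0 ≤ ∫ u in α..β, (2 * support x y a b p r u * l - S -
      Real.pi * support x y a b p r u ^ 2) * w u := by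
    refine intervalIntegral.integral_nonneg (H.lt_of_angle_add_pi hαβ).le fun u hu => ?_
    have := H.half_bonnesen hαβ hh hq hu
    exact mul_nonneg (by linarith) (H.w_pos u).le
  have h2 : ∀ l S : ℝ, ∫ u in α..β, (2 * support x y a b p r u * l - S -
      Real.pi * support x y a b p r u ^ 2) * w u =
      2 * l * (∫ u in α..β, support x y a b p r u * w u) - S * (∫ u in α..β, w u) -
      Real.pi * ∫ u in α..β, support x y a b p r u ^ 2 * w u := by
    intro l S
    rw [← intervalIntegral.integral_const_mul, ← intervalIntegral.integral_const_mul,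
      ← intervalIntegral.integral_const_mul,
      ← intervalIntegral.integral_sub (Continuous.intervalIntegrable (by fun_prop) _ _)
      (Continuous.intervalIntegrable (by fun_prop) _ _),
      ← intervalIntegral.integral_sub (Continuous.intervalIntegrable (by fun_prop) _ _)
      (Continuous.intervalIntegrable (by fun_prop) _ _)]
    congr 1
    ext u
    ring
  have h5 := h2 l S
  rw [h3, h4] at h5
  nlinarith

/-- With the radius of curvature `ρ = g / w`, the function `ρ + h` has mean `2 l / π` over the arc,
and it is constant on a circle about the origin. The nonnegativity of its variance bounds `∫ ρ² dθ`
from below in terms of `∫ h² dθ`, which the preceding lemma bounds from above. -/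
lemma half_greenOsher (H : ConvexFrame x y a b g w)
    (hαβ : angle w β = angle w α + Real.pi)
    (hh : support x y a b p r α = support x y a b p r β)
    (hq : tangential x y a b p r α = tangential x y a b p r β) :
    2 * (∫ u in α..β, g u) ^ 2 / Real.pi - (∫ u in α..β, support x y a b p r u * g u) ≤
      ∫ u in α..β, g u ^ 2 / w u := by
  have hw := H.w_cont
  have hg := H.g_cont
  have hs := H.support_cont p r
  have hw0 := fun u => (H.w_pos u).ne'
  have h3 := H.half_integral_speed hq
  have h4 : ∫ u in α..β, w u = Real.pi := by rw [H.angle_sub]; linarith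
  have h5 := H.half_integral_support_sq hαβ hh hq
  set S := ∫ u in α..β, support x y a b p r u * g u with hS
  set l := ∫ u in α..β, g u with hl
  have hρ : Continuous fun u => g u ^ 2 / w u := (hg.pow 2).div hw hw0
  set k := 2 * l / Real.pi with hk
  have h1 : 0 ≤ ∫ u in α..β, (g u / w u + support x y a b p r u - k) ^ 2 * w u :=
    intervalIntegral.integral_nonneg (H.lt_of_angle_add_pi hαβ).le fun u hu =>
      mul_nonneg (sq_nonneg _) (H.w_pos u).le
  have h2 : ∫ u in α..β, (g u / w u + support x y a b p r u - k) ^ 2 * w u =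
      (∫ u in α..β, g u ^ 2 / w u) + (∫ u in α..β, support x y a b p r u ^ 2 * w u) +
      k ^ 2 * (∫ u in α..β, w u) + 2 * S - 2 * k * l -
      2 * k * ∫ u in α..β, support x y a b p r u * w u := by
    rw [hS, hl]
    simp only [← intervalIntegral.integral_const_mul]
    rw [← intervalIntegral.integral_add (hρ.intervalIntegrable _ _)
        (Continuous.intervalIntegrable (by fun_prop) _ _),
      ← intervalIntegral.integral_add (Continuous.intervalIntegrable (by fun_prop) _ _)
        (Continuous.intervalIntegrable (by fun_prop) _ _),
      ← intervalIntegral.integral_add (Continuous.intervalIntegrable (by fun_prop) _ _)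
        (Continuous.intervalIntegrable (by fun_prop) _ _),
      ← intervalIntegral.integral_sub (Continuous.intervalIntegrable (by fun_prop) _ _)
        (Continuous.intervalIntegrable (by fun_prop) _ _),
      ← intervalIntegral.integral_sub (Continuous.intervalIntegrable (by fun_prop) _ _)
        (Continuous.intervalIntegrable (by fun_prop) _ _)]
    congr 1
    ext u
    have := hw0 u
    field_simp
    ring
  rw [h3, h4] at h2
  rw [h2] at h1
  have hπ := Real.pi_pos
  have h6 : ∫ u in α..β, support x y a b p r u ^ 2 * w u ≤ 2 * l ^ 2 / Real.pi - S := by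
    rw [le_sub_iff_add_le, le_div_iff₀ hπ]
    linarith
  have h7 : k ^ 2 * Real.pi = 4 * l ^ 2 / Real.pi := by rw [hk]; field_simp; ring
  have h8 : k * l = 2 * l ^ 2 / Real.pi := by rw [hk]; ring
  have h9 : 4 * l ^ 2 / Real.pi = 2 * (2 * l ^ 2 / Real.pi) := by ring
  linarith

end HalfTurn

end ConvexFrame

end CurveFlow

namespace CurveFlow

namespace ConvexFrame

variable {x y a b g w : ℝ → ℝ} {A : ℝ}

/-! ### The area-bisecting chord with parallel end tangents -/

/-- Moving the origin changes `∫ h ds` only by a term in the end points; on a closed curve it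
changes nothing. -/
lemma integral_support_translate (H : ConvexFrame x y a b g w) (p r α β : ℝ) :
    ∫ u in α..β, support x y a b p r u * g u = (∫ u in α..β, support x y a b 0 0 u * g u) -
      p * (y β - y α) + r * (x β - x α) := by
  have hg := H.g_cont
  have ha := H.a_cont
  have hb := H.b_cont
  have hs := H.support_cont 0 0
  rw [← intervalIntegral.integral_eq_sub_of_hasDerivAt (fun u _ => H.deriv_x u)
    (Continuous.intervalIntegrable (by fun_prop) _ _),
    ← intervalIntegral.integral_eq_sub_of_hasDerivAt (fun u _ => H.deriv_y u)
    (Continuous.intervalIntegrable (by fun_prop) _ _), ← intervalIntegral.integral_const_mul,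
    ← intervalIntegral.integral_const_mul,
    ← intervalIntegral.integral_sub (Continuous.intervalIntegrable (by fun_prop) _ _)
      (Continuous.intervalIntegrable (by fun_prop) _ _),
    ← intervalIntegral.integral_add (Continuous.intervalIntegrable (by fun_prop) _ _)
      (Continuous.intervalIntegrable (by fun_prop) _ _)]
  congr 1
  ext u
  simp only [support]
  ring

lemma integral_period (f : ℝ → ℝ) (hf : Continuous f) (hp : Function.Periodic f (2 * Real.pi))
    (α β : ℝ) : ∫ u in (0 : ℝ)..(2 * Real.pi), f u =
      (∫ u in α..β, f u) + ∫ u in β..(α + 2 * Real.pi), f u := by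
  have := hp.intervalIntegral_add_eq 0 α
  rw [zero_add] at this
  rw [this, intervalIntegral.integral_add_adjacent_intervals (hf.intervalIntegrable _ _)
    (hf.intervalIntegrable _ _)]

/-- There is a chord with parallel end tangents which bisects the area; we take its midpoint as
the origin of the support function. -/
theorem exists_bisecting_chord (H : ConvexFrame x y a b g w)
    (hA : ∫ u in (0 : ℝ)..(2 * Real.pi), support x y a b 0 0 u * g u = 2 * A) :
    ∃ p r α β, angle w β = angle w α + Real.pi ∧
      angle w (α + 2 * Real.pi) = angle w β + Real.pi ∧
      support x y a b p r α = support x y a b p r β ∧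
      tangential x y a b p r α = tangential x y a b p r β ∧
      support x y a b p r β = support x y a b p r (α + 2 * Real.pi) ∧
      tangential x y a b p r β = tangential x y a b p r (α + 2 * Real.pi) ∧
      ∫ u in α..β, support x y a b p r u * g u = A ∧
      ∫ u in β..(α + 2 * Real.pi), support x y a b p r u * g u = A := by
  have hs0 := H.support_cont 0 0
  have hg := H.g_cont
  have hx := H.x_cont
  have hy := H.y_cont
  have hsg : Continuous fun u => support x y a b 0 0 u * g u := hs0.mul hg
  let e := H.angle_strictMono.orderIsoOfSurjective _ H.angle_surjective
  have he : ∀ u, e u = angle w u := fun u => rfl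
  -- `B` sends a parameter to the next one with opposite tangent; applied twice it advances by a
  -- full period.
  set B : ℝ → ℝ := fun α => e.symm (e α + Real.pi) with hB
  have hBc : Continuous B := e.symm.continuous.comp (e.continuous.add continuous_const)
  have hBang : ∀ α, angle w (B α) = angle w α + Real.pi := fun α => by
    rw [← he, ← he, hB]
    simp
  have hBB : ∀ α, B (B α) = α + 2 * Real.pi := fun α => by
    apply H.angle_strictMono.injective
    rw [hBang, hBang, H.angle_add_period]
    ring
  set P : ℝ → ℝ := fun v => ∫ u in (0 : ℝ)..v, support x y a b 0 0 u * g u with hP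
  have hPc : Continuous P :=
    intervalIntegral.continuous_primitive (fun _ _ => hsg.intervalIntegrable _ _) 0
  have hPsub : ∀ α β, ∫ u in α..β, support x y a b 0 0 u * g u = P β - P α := fun α β =>
    (intervalIntegral.integral_interval_sub_left (hsg.intervalIntegrable _ _)
      (hsg.intervalIntegrable _ _)).symm
  have hper : Function.Periodic (fun u => support x y a b 0 0 u * g u) (2 * Real.pi) :=
    fun u => by simp only [H.support_per 0 0 u, H.g_per u]
  -- `Φ α` is the integral of `h ds` over the arc from `α` to `B α` when the origin is the midpoint
  -- of the chord, that is, twice the area between arc and chord. The arcs starting at `α` and at `B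
  -- α` are complementary, so their values add up to `2A` and an intermediate value equals `A`.
  set Φ : ℝ → ℝ := fun α => P (B α) - P α - (x α * y (B α) - y α * x (B α)) with hΦ
  have hΦc : Continuous Φ := by fun_prop
  have hsum : ∀ α, Φ α + Φ (B α) = 2 * A := fun α => by
    have h1 := integral_period _ hsg hper α (B α)
    rw [hA, hPsub, hPsub] at h1
    simp only [hΦ, hBB, H.x_per α, H.y_per α]
    linarith
  have hmem : A ∈ range Φ := by
    have h0 := hsum 0
    rcases le_total (Φ 0) A with h | h
    · exact mem_range_of_exists_le_of_exists_ge hΦc ⟨0, h⟩ ⟨B 0, by linarith⟩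
    · exact mem_range_of_exists_le_of_exists_ge hΦc ⟨B 0, by linarith⟩ ⟨0, h⟩
  obtain ⟨α, hα⟩ := hmem
  set β := B α with hβ
  obtain ⟨ha, hb⟩ := H.neg_of_angle_add_pi (hBang α)
  have hS : ∫ u in α..β, support x y a b ((x α + x β) / 2) ((y α + y β) / 2) u * g u = A := by
    rw [H.integral_support_translate, hPsub, ← hα]
    simp only [hΦ]
    ring
  have h2 : support x y a b ((x α + x β) / 2) ((y α + y β) / 2) α =
      support x y a b ((x α + x β) / 2) ((y α + y β) / 2) β := by
    simp only [support, hβ, ha, hb]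
    ring
  have h3 : tangential x y a b ((x α + x β) / 2) ((y α + y β) / 2) α =
      tangential x y a b ((x α + x β) / 2) ((y α + y β) / 2) β := by
    simp only [tangential, hβ, ha, hb]
    ring
  refine ⟨(x α + x β) / 2, (y α + y β) / 2, α, β, hBang α, ?_, h2, h3, ?_, ?_, hS, ?_⟩
  · rw [H.angle_add_period, hBang]
    ring
  · rw [H.support_per, h2]
  · rw [← h3]
    simp only [tangential, H.x_per α, H.y_per α, H.a_per α, H.b_per α]
  · have h4 := integral_period _ hsg hper α β
    rw [hA] at h4
    have h5 := H.integral_support_translate ((x α + x β) / 2) ((y α + y β) / 2) α β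
    have h6 := H.integral_support_translate ((x α + x β) / 2) ((y α + y β) / 2) β
      (α + 2 * Real.pi)
    rw [H.x_per, H.y_per] at h6
    rw [hS] at h5
    rw [h6]
    linarith

/-! ### Inequalities for closed convex curves -/

/-- A quadratic in `h` with positive leading coefficient that takes a nonpositive value has
nonnegative discriminant. -/
lemma pi_mul_le_sq_of_bonnesen {S l h : ℝ} (H : S - 2 * h * l + Real.pi * h ^ 2 ≤ 0) :
    Real.pi * S ≤ l ^ 2 := by
  nlinarith [sq_nonneg (Real.pi * h - l), Real.pi_pos]

lemma integral_support_turn (H : ConvexFrame x y a b g w) (p r : ℝ) :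
    ∫ u in (0 : ℝ)..(2 * Real.pi), support x y a b p r u * w u =
      ∫ u in (0 : ℝ)..(2 * Real.pi), g u := by
  refine H.half_integral_speed ?_
  have h1 := H.x_per 0
  have h2 := H.y_per 0
  have h3 := H.a_per 0
  have h4 := H.b_per 0
  rw [zero_add] at h1 h2 h3 h4
  simp only [tangential, h1, h2, h3, h4]

/-- Gage's inequality `∮ κ² ds ≥ π L / A`. -/
theorem gage_inequality (H : ConvexFrame x y a b g w)
    (hA : ∫ u in (0 : ℝ)..(2 * Real.pi), support x y a b 0 0 u * g u = 2 * A) (hApos : 0 < A) :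
    Real.pi * (∫ u in (0 : ℝ)..(2 * Real.pi), g u) / A ≤
      ∫ u in (0 : ℝ)..(2 * Real.pi), w u ^ 2 / g u := by
  obtain ⟨p, r, α, β, hβ, hα, hh, hq, hh', hq', hS, hS'⟩ := H.exists_bisecting_chord hA
  have hw := H.w_cont
  have hg := H.g_cont
  have hs := H.support_cont p r
  have hg0 := fun u => (H.g_pos u).ne'
  have h1 := H.half_gage hβ hh hq
  have h2 := H.half_gage hα hh' hq'
  rw [hS] at h1
  rw [hS'] at h2
  have h3 := integral_period (fun u => support x y a b p r u ^ 2 * g u) (by fun_prop)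
    (fun u => by simp only [H.support_per p r u, H.g_per u]) α β
  have h4 := integral_period g hg H.g_per α β
  have h5 := H.integral_support_turn p r
  set L := ∫ u in (0 : ℝ)..(2 * Real.pi), g u with hL
  -- On a circle about the origin `κ = (π / A) h`. The proof expands `∮ (κ - k h)² ds ≥ 0`, using `∮
  -- h κ ds = L` and `π ∮ h² ds ≤ A L`, the sum of the two half estimates.
  set k := Real.pi / A with hk
  have hκ : Continuous fun u => w u ^ 2 / g u := (hw.pow 2).div hg hg0
  have h6 : 0 ≤ ∫ u in (0 : ℝ)..(2 * Real.pi), (w u / g u - k * support x y a b p r u) ^ 2 * g u :=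
    intervalIntegral.integral_nonneg Real.two_pi_pos.le fun u hu =>
      mul_nonneg (sq_nonneg _) (H.g_pos u).le
  have h7 : ∫ u in (0 : ℝ)..(2 * Real.pi), (w u / g u - k * support x y a b p r u) ^ 2 * g u =
      (∫ u in (0 : ℝ)..(2 * Real.pi), w u ^ 2 / g u) -
      2 * k * (∫ u in (0 : ℝ)..(2 * Real.pi), support x y a b p r u * w u) +
      k ^ 2 * ∫ u in (0 : ℝ)..(2 * Real.pi), support x y a b p r u ^ 2 * g u := by
    simp only [← intervalIntegral.integral_const_mul]
    rw [← intervalIntegral.integral_sub (hκ.intervalIntegrable _ _)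
        (Continuous.intervalIntegrable (by fun_prop) _ _),
      ← intervalIntegral.integral_add (Continuous.intervalIntegrable (by fun_prop) _ _)
        (Continuous.intervalIntegrable (by fun_prop) _ _)]
    congr 1
    ext u
    have := hg0 u
    field_simp
    ring
  rw [h5] at h7
  have hkA : k * A = Real.pi := by rw [hk]; field_simp
  have hkpos : 0 < k := div_pos Real.pi_pos hApos
  have h8 : k ^ 2 * (∫ u in (0 : ℝ)..(2 * Real.pi), support x y a b p r u ^ 2 * g u) ≤ k * L := by
    have : Real.pi * (∫ u in (0 : ℝ)..(2 * Real.pi), support x y a b p r u ^ 2 * g u) ≤ A * L := by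
      rw [h3, h4]
      linarith
    have h9 : k * (∫ u in (0 : ℝ)..(2 * Real.pi), support x y a b p r u ^ 2 * g u) ≤ L := by
      rw [hk, div_mul_eq_mul_div, div_le_iff₀ hApos]
      linarith
    nlinarith
  rw [mul_div_right_comm, ← hk]
  linarith

/-- The Green–Osher inequality `∮ κ⁻¹ ds ≥ (L² - 2 π A) / π`. -/
theorem greenOsher_inequality (H : ConvexFrame x y a b g w)
    (hA : ∫ u in (0 : ℝ)..(2 * Real.pi), support x y a b 0 0 u * g u = 2 * A) :
    ((∫ u in (0 : ℝ)..(2 * Real.pi), g u) ^ 2 - 2 * Real.pi * A) / Real.pi ≤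
      ∫ u in (0 : ℝ)..(2 * Real.pi), g u ^ 2 / w u := by
  obtain ⟨p, r, α, β, hβ, hα, hh, hq, hh', hq', hS, hS'⟩ := H.exists_bisecting_chord hA
  have h1 := H.half_greenOsher hβ hh hq
  have h2 := H.half_greenOsher hα hh' hq'
  rw [hS] at h1
  rw [hS'] at h2
  have h3 := integral_period (fun u => g u ^ 2 / w u)
    ((H.g_cont.pow 2).div H.w_cont fun u => (H.w_pos u).ne')
    (fun u => by simp only [H.g_per u, H.w_per u]) α β
  rw [h3, integral_period g H.g_cont H.g_per α β]
  refine le_trans ?_ (add_le_add h1 h2)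
  have hπ := Real.pi_pos
  rw [div_sub' hπ.ne', div_sub' hπ.ne', ← add_div]
  refine div_le_div_of_nonneg_right ?_ hπ.le
  -- The halves need not have equal length; `2 (l² + l'²) ≥ (l + l')²` suffices.
  nlinarith [sq_nonneg ((∫ u in α..β, g u) - ∫ u in β..(α + 2 * Real.pi), g u)]

/-- Collects what the bisecting chord gives for the whole curve: by periodicity each value of the
support function is attained on one of the two arcs and satisfies the Bonnesen inequality with the
length of that arc. -/
lemma half_length_bounds (H : ConvexFrame x y a b g w)
    (hA : ∫ u in (0 : ℝ)..(2 * Real.pi), support x y a b 0 0 u * g u = 2 * A) :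
    ∃ p r l l', Real.pi * A ≤ l ^ 2 ∧ Real.pi * A ≤ l' ^ 2 ∧ 0 ≤ l ∧ 0 ≤ l' ∧
      l + l' = ∫ u in (0 : ℝ)..(2 * Real.pi), g u ∧
      ∀ u, A - 2 * support x y a b p r u * l + Real.pi * support x y a b p r u ^ 2 ≤ 0 ∨
        A - 2 * support x y a b p r u * l' + Real.pi * support x y a b p r u ^ 2 ≤ 0 := by
  obtain ⟨p, r, α, β, hβ, hα, hh, hq, hh', hq', hS, hS'⟩ := H.exists_bisecting_chord hA
  have h1 := H.lt_of_angle_add_pi hβ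
  have h2 := H.lt_of_angle_add_pi hα
  have b1 := fun {c} => H.half_bonnesen (c := c) hβ hh hq
  have b2 := fun {c} => H.half_bonnesen (c := c) hα hh' hq'
  rw [hS] at b1
  rw [hS'] at b2
  refine ⟨p, r, _, _, pi_mul_le_sq_of_bonnesen (b1 (left_mem_Icc.2 h1.le)),
    pi_mul_le_sq_of_bonnesen (b2 (left_mem_Icc.2 h2.le)),
    intervalIntegral.integral_nonneg h1.le fun u _ => (H.g_pos u).le,
    intervalIntegral.integral_nonneg h2.le fun u _ => (H.g_pos u).le,
    (integral_period g H.g_cont H.g_per α β).symm, fun u => ?_⟩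
  obtain ⟨v, hv, huv⟩ := (H.support_per p r).exists_mem_Ico Real.two_pi_pos u α
  rw [huv]
  rcases le_total v β with h | h
  · exact Or.inl (b1 ⟨hv.1, h⟩)
  · exact Or.inr (b2 ⟨h, hv.2.le⟩)

/-- The isoperimetric inequality. -/
theorem isoperimetric_inequality (H : ConvexFrame x y a b g w)
    (hA : ∫ u in (0 : ℝ)..(2 * Real.pi), support x y a b 0 0 u * g u = 2 * A) :
    4 * Real.pi * A ≤ (∫ u in (0 : ℝ)..(2 * Real.pi), g u) ^ 2 := by
  obtain ⟨p, r, l, l', h1, h2, h3, h4, h5, -⟩ := H.half_length_bounds hA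
  rw [← h5]
  rcases le_total l l' with h | h <;> nlinarith

/-- The radius bound `|h - R| ≤ δ` in terms of the excess of the length. -/
theorem exists_center (H : ConvexFrame x y a b g w)
    (hA : ∫ u in (0 : ℝ)..(2 * Real.pi), support x y a b 0 0 u * g u = 2 * A) (hApos : 0 < A) :
    ∃ p r, ∀ u, |support x y a b p r u - √(A / Real.pi)| ≤
      √((∫ v in (0 : ℝ)..(2 * Real.pi), g v) ^ 2 - 4 * Real.pi * A) := by
  obtain ⟨p, r, l, l', h1, h2, h3, h4, h5, h6⟩ := H.half_length_bounds hA
  refine ⟨p, r, fun u => ?_⟩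
  rw [← h5]
  have hπ := Real.pi_pos
  set R := √(A / Real.pi) with hR
  have hRA : Real.pi * R ^ 2 = A := by
    rw [hR, Real.sq_sqrt (div_pos hApos hπ).le]
    field_simp
  have hR0 : 0 ≤ R := Real.sqrt_nonneg _
  apply Real.le_sqrt_of_sq_le
  rw [sq_abs]
  set k := support x y a b p r u
  have hl : Real.pi * R ≤ l := by
    refine (sq_le_sq₀ (mul_nonneg hπ.le hR0) h3).1 ?_
    rw [mul_pow]
    nlinarith
  have hl' : Real.pi * R ≤ l' := by
    refine (sq_le_sq₀ (mul_nonneg hπ.le hR0) h4).1 ?_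
    rw [mul_pow]
    nlinarith
  -- Completing the square gives `(πk - m)² ≤ m² - (πR)²`, and `(m - πR)²` has the same bound
  -- because `m ≥ πR`. Adding the two distances yields a factor `4`, which `π² ≥ 4` absorbs.
  have key : ∀ m m', Real.pi * R ≤ m → Real.pi * R ≤ m' → A - 2 * k * m + Real.pi * k ^ 2 ≤ 0 →
      (k - R) ^ 2 ≤ (m + m') ^ 2 - 4 * Real.pi * A := by
    intro m m' hm hm' hk
    have hRpos : 0 ≤ Real.pi * R := mul_nonneg hπ.le hR0
    have e1 : (Real.pi * k - m) ^ 2 ≤ m ^ 2 - (Real.pi * R) ^ 2 := by nlinarith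
    have e2 : (m - Real.pi * R) ^ 2 ≤ m ^ 2 - (Real.pi * R) ^ 2 := by nlinarith
    have e3 : Real.pi ^ 2 * (k - R) ^ 2 ≤ 4 * (m ^ 2 - (Real.pi * R) ^ 2) := by
      nlinarith [sq_nonneg (Real.pi * k - m - (m - Real.pi * R))]
    have e4 : 4 * (k - R) ^ 2 ≤ Real.pi ^ 2 * (k - R) ^ 2 :=
      mul_le_mul_of_nonneg_right (by nlinarith [Real.pi_gt_three]) (sq_nonneg _)
    have e5 : m ^ 2 - (Real.pi * R) ^ 2 ≤ (m + m') ^ 2 - 4 * (Real.pi * R) ^ 2 := by nlinarith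
    have e6 : 4 * (Real.pi * R) ^ 2 = 4 * Real.pi * A := by rw [← hRA]; ring
    linarith
  rcases h6 u with h | h
  · exact key l l' hl hl' h
  · rw [add_comm]
    exact key l' l hl' hl h

end ConvexFrame

end CurveFlow

namespace CurveFlow

variable {x y a b g w : ℝ → ℝ}

/-! ### Simple convex curves turn once -/

/-- As a function of the point of tangency, the distance from `X v` to the tangent line is
nonnegative. A zero is thus a minimum, where the derivative `w q` vanishes; with `h = q = 0` the two
points coincide. -/
lemma eq_of_support_eq_zero (hx : ∀ u, HasDerivAt x (g u * a u) u)
    (hy : ∀ u, HasDerivAt y (g u * b u) u) (ha : ∀ u, HasDerivAt a (-(w u * b u)) u)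
    (hb : ∀ u, HasDerivAt b (w u * a u) u) (hunit : ∀ u, a u ^ 2 + b u ^ 2 = 1)
    (hw : ∀ u, 0 < w u) (hconv : ∀ u v, 0 ≤ support x y a b (x v) (y v) u) {u v : ℝ}
    (h : support x y a b (x v) (y v) u = 0) : x u = x v ∧ y u = y v := by
  have hd : HasDerivAt (support x y a b (x v) (y v))
      (w u * tangential x y a b (x v) (y v) u) u := by
    refine ((((hx u).sub_const (x v)).mul (hb u)).sub
      (((hy u).sub_const (y v)).mul (ha u))).congr_deriv ?_
    simp only [tangential]
    ring
  have hmin : IsLocalMin (support x y a b (x v) (y v)) u :=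
    Filter.Eventually.of_forall fun s => by rw [h]; exact hconv s v
  have h0 := (mul_eq_zero.1 (hmin.hasDerivAt_eq_zero hd)).resolve_left (hw u).ne'
  have hu := hunit u
  simp only [support, tangential] at h h0
  constructor
  · linear_combination (-(x u - x v)) * hu + a u * h0 + b u * h
  · linear_combination (-(y u - y v)) * hu + b u * h0 - a u * h

/-- The tangent of a simple convex closed curve makes exactly one turn. -/
theorem total_turn_of_simple (hx : ∀ u, HasDerivAt x (g u * a u) u)
    (hy : ∀ u, HasDerivAt y (g u * b u) u) (ha : ∀ u, HasDerivAt a (-(w u * b u)) u)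
    (hb : ∀ u, HasDerivAt b (w u * a u) u) (hunit : ∀ u, a u ^ 2 + b u ^ 2 = 1)
    (hw : ∀ u, 0 < w u) (hwc : Continuous w)
    (hconv : ∀ u v, 0 ≤ support x y a b (x v) (y v) u)
    (hsimple : ∀ u ∈ Ioo 0 (2 * Real.pi), ¬(x u = x 0 ∧ y u = y 0))
    (ha2 : a (2 * Real.pi) = a 0) (hb2 : b (2 * Real.pi) = b 0) :
    ∫ u in (0 : ℝ)..(2 * Real.pi), w u = 2 * Real.pi := by
  have hmono : StrictMono (angle w) := strictMono_of_hasDerivAt_pos (hasDerivAt_angle hwc) hw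
  have hcont : Continuous (angle w) :=
    continuous_iff_continuousAt.2 fun u => (hasDerivAt_angle hwc u).continuousAt
  have h0 : angle w 0 = 0 := intervalIntegral.integral_same
  change angle w (2 * Real.pi) = 2 * Real.pi
  have hpos : 0 < angle w (2 * Real.pi) := by rw [← h0]; exact hmono Real.two_pi_pos
  obtain ⟨h1, h2⟩ := rotation_of_angle ha hb hwc (2 * Real.pi)
  rw [ha2] at h1
  rw [hb2] at h2
  -- The tangent returns to its initial value after one period, so the positive total angle has
  -- cosine `1`.
  have hcos : Real.cos (angle w (2 * Real.pi)) = 1 := by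
    linear_combination (-(Real.cos (angle w (2 * Real.pi))) + 1) * hunit 0 - a 0 * h1 - b 0 * h2
  apply le_antisymm
  · by_contra! hlt
    -- If the tangent turned by more than `2π`, it would repeat its initial direction at some `u`
    -- inside the period. Each of the two points lies to the left of the other's tangent line, and
    -- these lines are parallel with the same direction, so they coincide and `X u = X 0`, against
    -- simplicity.
    obtain ⟨u, hu, hu2⟩ := intermediate_value_Ioo Real.two_pi_pos.le hcont.continuousOn
      (show 2 * Real.pi ∈ Ioo (angle w 0) (angle w (2 * Real.pi)) from
        ⟨by rw [h0]; exact Real.two_pi_pos, hlt⟩)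
    obtain ⟨h3, h4⟩ := rotation_of_angle ha hb hwc u
    rw [hu2, Real.cos_two_pi, Real.sin_two_pi] at h3 h4
    have h5 := hconv 0 u
    have h6 := hconv u 0
    refine hsimple u hu (eq_of_support_eq_zero hx hy ha hb hunit hw hconv (le_antisymm ?_ h6))
    simp only [support] at h5 ⊢
    rw [h3, h4]
    linarith
  · by_contra! hlt
    exact hpos.ne' ((Real.cos_eq_one_iff_of_lt_of_lt (by linarith) hlt).1 hcos)

/-- The area of a simple convex closed curve is positive. -/
theorem area_pos_of_simple (hx : ∀ u, HasDerivAt x (g u * a u) u)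
    (hy : ∀ u, HasDerivAt y (g u * b u) u) (ha : ∀ u, HasDerivAt a (-(w u * b u)) u)
    (hb : ∀ u, HasDerivAt b (w u * a u) u) (hunit : ∀ u, a u ^ 2 + b u ^ 2 = 1)
    (hw : ∀ u, 0 < w u) (hg : ∀ u, 0 < g u) (hgc : Continuous g)
    (hconv : ∀ u v, 0 ≤ support x y a b (x v) (y v) u)
    (hsimple : ∀ u ∈ Ioo 0 (2 * Real.pi), ¬(x u = x 0 ∧ y u = y 0)) :
    0 < ∫ u in (0 : ℝ)..(2 * Real.pi), support x y a b (x 0) (y 0) u * g u := by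
  have hxc : Continuous x := continuous_iff_continuousAt.2 fun u => (hx u).continuousAt
  have hyc : Continuous y := continuous_iff_continuousAt.2 fun u => (hy u).continuousAt
  have hac : Continuous a := continuous_iff_continuousAt.2 fun u => (ha u).continuousAt
  have hbc : Continuous b := continuous_iff_continuousAt.2 fun u => (hb u).continuousAt
  refine intervalIntegral.intervalIntegral_pos_of_pos_on
    (Continuous.intervalIntegrable (by unfold support; fun_prop) _ _) (fun u hu => ?_)
    Real.two_pi_pos
  refine mul_pos ((hconv u 0).lt_of_ne fun h => hsimple u hu ?_) (hg u)
  exact eq_of_support_eq_zero hx hy ha hb hunit hw hconv h.symm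

/-! ### Moments of the unit tangent against arc length and angle -/

namespace ConvexFrame

lemma abs_a_le (H : ConvexFrame x y a b g w) (u : ℝ) : |a u| ≤ 1 :=
  abs_le_one_iff_mul_self_le_one.2 (by nlinarith [H.unit u, sq_nonneg (b u)])

lemma abs_b_le (H : ConvexFrame x y a b g w) (u : ℝ) : |b u| ≤ 1 :=
  abs_le_one_iff_mul_self_le_one.2 (by nlinarith [H.unit u, sq_nonneg (a u)])

lemma integral_deriv_eq_zero {f f' : ℝ → ℝ} (hf : ∀ u, HasDerivAt f (f' u) u)
    (hp : Function.Periodic f (2 * Real.pi)) (hc : Continuous f') :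
    ∫ u in (0 : ℝ)..(2 * Real.pi), f' u = 0 := by
  rw [intervalIntegral.integral_eq_sub_of_hasDerivAt (fun u _ => hf u)
    (hc.intervalIntegrable _ _)]
  have := hp 0
  rw [zero_add] at this
  rw [this, sub_self]

lemma integral_g_a (H : ConvexFrame x y a b g w) :
    ∫ u in (0 : ℝ)..(2 * Real.pi), g u * a u = 0 :=
  integral_deriv_eq_zero H.deriv_x H.x_per (H.g_cont.mul H.a_cont)

lemma integral_g_b (H : ConvexFrame x y a b g w) :
    ∫ u in (0 : ℝ)..(2 * Real.pi), g u * b u = 0 :=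
  integral_deriv_eq_zero H.deriv_y H.y_per (H.g_cont.mul H.b_cont)

lemma integral_w_a (H : ConvexFrame x y a b g w) :
    ∫ u in (0 : ℝ)..(2 * Real.pi), w u * a u = 0 :=
  integral_deriv_eq_zero H.deriv_b H.b_per (H.w_cont.mul H.a_cont)

lemma integral_w_b (H : ConvexFrame x y a b g w) :
    ∫ u in (0 : ℝ)..(2 * Real.pi), w u * b u = 0 := by
  have h := integral_deriv_eq_zero H.deriv_a H.a_per (H.w_cont.mul H.b_cont).neg
  rw [intervalIntegral.integral_neg] at h
  exact neg_eq_zero.1 h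

lemma integral_w_a_b (H : ConvexFrame x y a b g w) :
    ∫ u in (0 : ℝ)..(2 * Real.pi), w u * (a u * b u) = 0 := by
  have ha := H.a_cont
  have hb := H.b_cont
  have hw := H.w_cont
  have h := integral_deriv_eq_zero (f := fun u => a u ^ 2)
    (f' := fun u => -2 * (w u * (a u * b u)))
    (fun u => ((H.deriv_a u).pow 2).congr_deriv (by push_cast; ring))
    (fun u => by simp only [H.a_per u]) (by fun_prop)
  rw [intervalIntegral.integral_const_mul] at h
  linarith

lemma integral_w_sq (H : ConvexFrame x y a b g w) :
    (∫ u in (0 : ℝ)..(2 * Real.pi), w u * a u ^ 2 = Real.pi) ∧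
      ∫ u in (0 : ℝ)..(2 * Real.pi), w u * b u ^ 2 = Real.pi := by
  have ha := H.a_cont
  have hb := H.b_cont
  have hw := H.w_cont
  have h := integral_deriv_eq_zero (f := fun u => a u * b u)
    (f' := fun u => w u * a u ^ 2 - w u * b u ^ 2)
    (fun u => ((H.deriv_a u).mul (H.deriv_b u)).congr_deriv (by ring))
    (fun u => by simp only [H.a_per u, H.b_per u]) (by fun_prop)
  rw [intervalIntegral.integral_sub (Continuous.intervalIntegrable (by fun_prop) _ _)
    (Continuous.intervalIntegrable (by fun_prop) _ _)] at h
  have h2 := H.total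
  rw [show (fun u => w u) = fun u => w u * a u ^ 2 + w u * b u ^ 2 from funext fun u => by
    rw [← mul_add, H.unit, mul_one],
    intervalIntegral.integral_add (Continuous.intervalIntegrable (by fun_prop) _ _)
    (Continuous.intervalIntegrable (by fun_prop) _ _)] at h2
  constructor <;> linarith

/-! ### The Steiner point -/

lemma abs_integral_le {f k : ℝ → ℝ} {δ : ℝ} (hf : Continuous f) (hk : Continuous k)
    (h : ∀ u, |f u| ≤ δ * k u) :
    |∫ u in (0 : ℝ)..(2 * Real.pi), f u| ≤ δ * ∫ u in (0 : ℝ)..(2 * Real.pi), k u := by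
  rw [← intervalIntegral.integral_const_mul]
  exact (intervalIntegral.abs_integral_le_integral_abs Real.two_pi_pos.le).trans
    (intervalIntegral.integral_mono_on Real.two_pi_pos.le (hf.abs.intervalIntegrable _ _)
      (Continuous.intervalIntegrable (by fun_prop) _ _) fun u _ => h u)

/-- If the support function with respect to a point is almost constant, then this point is close
to the Steiner point. -/
lemma steiner_close (H : ConvexFrame x y a b g w) {p r R δ : ℝ}
    (h : ∀ u, |support x y a b p r u - R| ≤ δ) :
    |1 / Real.pi * (∫ u in (0 : ℝ)..(2 * Real.pi), support x y a b 0 0 u * (w u * b u)) - p| ≤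
        2 * δ ∧
    |-(1 / Real.pi) * (∫ u in (0 : ℝ)..(2 * Real.pi), support x y a b 0 0 u * (w u * a u)) - r| ≤
        2 * δ := by
  have ha := H.a_cont
  have hb := H.b_cont
  have hw := H.w_cont
  have hs := H.support_cont 0 0
  have hs' := H.support_cont p r
  have hδ : 0 ≤ δ := (abs_nonneg _).trans (h 0)
  have hπ := Real.pi_pos
  have e1 : ∫ u in (0 : ℝ)..(2 * Real.pi), (support x y a b p r u - R) * (w u * b u) =
      (∫ u in (0 : ℝ)..(2 * Real.pi), support x y a b 0 0 u * (w u * b u)) - p * Real.pi := by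
    have : ∫ u in (0 : ℝ)..(2 * Real.pi), (support x y a b p r u - R) * (w u * b u) =
        (∫ u in (0 : ℝ)..(2 * Real.pi), support x y a b 0 0 u * (w u * b u)) -
        p * (∫ u in (0 : ℝ)..(2 * Real.pi), w u * b u ^ 2) +
        r * (∫ u in (0 : ℝ)..(2 * Real.pi), w u * (a u * b u)) -
        R * ∫ u in (0 : ℝ)..(2 * Real.pi), w u * b u := by
      simp only [← intervalIntegral.integral_const_mul]
      rw [← intervalIntegral.integral_sub (Continuous.intervalIntegrable (by fun_prop) _ _)
          (Continuous.intervalIntegrable (by fun_prop) _ _),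
        ← intervalIntegral.integral_add (Continuous.intervalIntegrable (by fun_prop) _ _)
          (Continuous.intervalIntegrable (by fun_prop) _ _),
        ← intervalIntegral.integral_sub (Continuous.intervalIntegrable (by fun_prop) _ _)
          (Continuous.intervalIntegrable (by fun_prop) _ _)]
      congr 1
      ext u
      simp only [support]
      ring
    rw [this, H.integral_w_sq.2, H.integral_w_a_b, H.integral_w_b]
    ring
  have e2 : ∫ u in (0 : ℝ)..(2 * Real.pi), (support x y a b p r u - R) * (w u * a u) =
      (∫ u in (0 : ℝ)..(2 * Real.pi), support x y a b 0 0 u * (w u * a u)) + r * Real.pi := by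
    have : ∫ u in (0 : ℝ)..(2 * Real.pi), (support x y a b p r u - R) * (w u * a u) =
        (∫ u in (0 : ℝ)..(2 * Real.pi), support x y a b 0 0 u * (w u * a u)) -
        p * (∫ u in (0 : ℝ)..(2 * Real.pi), w u * (a u * b u)) +
        r * (∫ u in (0 : ℝ)..(2 * Real.pi), w u * a u ^ 2) -
        R * ∫ u in (0 : ℝ)..(2 * Real.pi), w u * a u := by
      simp only [← intervalIntegral.integral_const_mul]
      rw [← intervalIntegral.integral_sub (Continuous.intervalIntegrable (by fun_prop) _ _)
          (Continuous.intervalIntegrable (by fun_prop) _ _),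
        ← intervalIntegral.integral_add (Continuous.intervalIntegrable (by fun_prop) _ _)
          (Continuous.intervalIntegrable (by fun_prop) _ _),
        ← intervalIntegral.integral_sub (Continuous.intervalIntegrable (by fun_prop) _ _)
          (Continuous.intervalIntegrable (by fun_prop) _ _)]
      congr 1
      ext u
      simp only [support]
      ring
    rw [this, H.integral_w_sq.1, H.integral_w_a_b, H.integral_w_a]
    ring
  have bound : ∀ f : ℝ → ℝ, (∀ u, |f u| ≤ 1) → ∀ u,
      |(support x y a b p r u - R) * (w u * f u)| ≤ δ * w u := by
    intro f hf u
    rw [abs_mul, abs_mul, abs_of_pos (H.w_pos u)]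
    refine mul_le_mul (h u) ?_ (by have := H.w_pos u; positivity) hδ
    exact mul_le_of_le_one_right (H.w_pos u).le (hf u)
  -- The integrals are at most `δ ∮ dθ = 2πδ`; division by `π` gives the bound `2δ`.
  have b1 := abs_integral_le (by fun_prop) hw (bound b H.abs_b_le)
  have b2 := abs_integral_le (by fun_prop) hw (bound a H.abs_a_le)
  rw [e1, H.total] at b1
  rw [e2, H.total] at b2
  constructor
  · rw [show ∀ I : ℝ, 1 / Real.pi * I - p = (1 / Real.pi) * (I - p * Real.pi) from
      fun I => by field_simp, abs_mul, abs_of_pos (by positivity), one_div_mul_eq_div,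
      div_le_iff₀ hπ]
    linarith
  · rw [show ∀ I : ℝ, -(1 / Real.pi) * I - r = -(1 / Real.pi) * (I + r * Real.pi) from
      fun I => by field_simp; ring, abs_mul, abs_neg, abs_of_pos (by positivity),
      one_div_mul_eq_div, div_le_iff₀ hπ]
    linarith

/-- The speed bound of the Steiner point. -/
lemma abs_integral_curvature_le (H : ConvexFrame x y a b g w) {f : ℝ → ℝ} (hf : Continuous f)
    (hf1 : ∀ u, |f u| ≤ 1) (hgf : ∫ u in (0 : ℝ)..(2 * Real.pi), g u * f u = 0)
    (hwf : ∫ u in (0 : ℝ)..(2 * Real.pi), w u * f u = 0) (c : ℝ) :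
    |∫ u in (0 : ℝ)..(2 * Real.pi), (w u ^ 2 / g u - c * g u) * f u| ≤
      (∫ u in (0 : ℝ)..(2 * Real.pi), w u ^ 2 / g u) -
        4 * Real.pi ^ 2 / ∫ u in (0 : ℝ)..(2 * Real.pi), g u := by
  have hg := H.g_cont
  have hw := H.w_cont
  have hg0 := fun u => (H.g_pos u).ne'
  have hL : 0 < ∫ u in (0 : ℝ)..(2 * Real.pi), g u :=
    intervalIntegral.intervalIntegral_pos_of_pos (hg.intervalIntegrable _ _) H.g_pos
      Real.two_pi_pos
  have hκ : Continuous fun u => w u ^ 2 / g u := (hw.pow 2).div hg hg0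
  -- `k` is the mean curvature over the curve. Since `f` is orthogonal to `ds = g du` and `dθ = w
  -- du`, the term `c g` may be exchanged for `2 k w - k² g`. This turns the weight into the
  -- nonnegative `(κ - k)² ds`, whose integral is the right-hand side.
  set k := 2 * Real.pi / ∫ u in (0 : ℝ)..(2 * Real.pi), g u with hk
  have e1 : ∫ u in (0 : ℝ)..(2 * Real.pi), (w u ^ 2 / g u - c * g u) * f u =
      ∫ u in (0 : ℝ)..(2 * Real.pi), (w u ^ 2 / g u - 2 * k * w u + k ^ 2 * g u) * f u := by
    have h1 : ∫ u in (0 : ℝ)..(2 * Real.pi), (w u ^ 2 / g u - c * g u) * f u =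
        (∫ u in (0 : ℝ)..(2 * Real.pi), (w u ^ 2 / g u) * f u) -
        c * ∫ u in (0 : ℝ)..(2 * Real.pi), g u * f u := by
      simp only [← intervalIntegral.integral_const_mul]
      rw [← intervalIntegral.integral_sub (Continuous.intervalIntegrable (by fun_prop) _ _)
          (Continuous.intervalIntegrable (by fun_prop) _ _)]
      congr 1
      ext u
      ring
    have h2 : ∀ k : ℝ, ∫ u in (0 : ℝ)..(2 * Real.pi),
        (w u ^ 2 / g u - 2 * k * w u + k ^ 2 * g u) * f u =
        (∫ u in (0 : ℝ)..(2 * Real.pi), (w u ^ 2 / g u) * f u) -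
        2 * k * (∫ u in (0 : ℝ)..(2 * Real.pi), w u * f u) +
        k ^ 2 * ∫ u in (0 : ℝ)..(2 * Real.pi), g u * f u := by
      intro k
      simp only [← intervalIntegral.integral_const_mul]
      rw [← intervalIntegral.integral_sub (Continuous.intervalIntegrable (by fun_prop) _ _)
          (Continuous.intervalIntegrable (by fun_prop) _ _),
        ← intervalIntegral.integral_add (Continuous.intervalIntegrable (by fun_prop) _ _)
          (Continuous.intervalIntegrable (by fun_prop) _ _)]
      congr 1
      ext u
      ring
    rw [h1, h2, hgf, hwf]
    ring
  have e2 : ∀ k : ℝ, ∫ u in (0 : ℝ)..(2 * Real.pi), (w u ^ 2 / g u - 2 * k * w u + k ^ 2 * g u) =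
      (∫ u in (0 : ℝ)..(2 * Real.pi), w u ^ 2 / g u) -
      2 * k * (∫ u in (0 : ℝ)..(2 * Real.pi), w u) +
      k ^ 2 * ∫ u in (0 : ℝ)..(2 * Real.pi), g u := by
    intro k
    simp only [← intervalIntegral.integral_const_mul]
    rw [← intervalIntegral.integral_sub (Continuous.intervalIntegrable (by fun_prop) _ _)
        (Continuous.intervalIntegrable (by fun_prop) _ _),
      ← intervalIntegral.integral_add (Continuous.intervalIntegrable (by fun_prop) _ _)
        (Continuous.intervalIntegrable (by fun_prop) _ _)]
  have h3 := abs_integral_le (δ := 1)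
    (f := fun u => (w u ^ 2 / g u - 2 * k * w u + k ^ 2 * g u) * f u)
    (k := fun u => w u ^ 2 / g u - 2 * k * w u + k ^ 2 * g u) (by fun_prop) (by fun_prop)
    (fun u => by
      have : w u ^ 2 / g u - 2 * k * w u + k ^ 2 * g u = (w u - k * g u) ^ 2 / g u := by
        have := hg0 u
        field_simp
        ring
      rw [this, one_mul, abs_mul, abs_of_nonneg (div_nonneg (sq_nonneg _) (H.g_pos u).le)]
      exact mul_le_of_le_one_right (div_nonneg (sq_nonneg _) (H.g_pos u).le) (hf1 u))
  rw [e1]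
  refine h3.trans (le_of_eq ?_)
  rw [one_mul, e2, H.total, hk]
  field_simp
  ring

/-! ### Closeness to a circle -/

/-- `|X - O|` is at most the maximum of the support function. -/
lemma sq_add_sq_le (H : ConvexFrame x y a b g w) {p r M : ℝ}
    (h : ∀ u, |support x y a b p r u| ≤ M) (u : ℝ) :
    support x y a b p r u ^ 2 + tangential x y a b p r u ^ 2 ≤ M ^ 2 := by
  set Q : ℝ → ℝ := fun u => support x y a b p r u ^ 2 + tangential x y a b p r u ^ 2 with hQ
  have hQc : Continuous Q := ((H.support_cont p r).pow 2).add ((H.tangential_cont p r).pow 2)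
  have hQp : Function.Periodic Q (2 * Real.pi) := fun u => by
    simp only [hQ, support, tangential, H.x_per u, H.y_per u, H.a_per u, H.b_per u]
  obtain ⟨v, -, hv⟩ := isCompact_Icc.exists_isMaxOn
    (nonempty_Icc.2 Real.two_pi_pos.le) hQc.continuousOn
  have hmax : ∀ s, Q s ≤ Q v := fun s => by
    obtain ⟨s', hs', e⟩ := hQp.exists_mem_Ico₀ Real.two_pi_pos s
    rw [e]
    exact hv (Ico_subset_Icc_self hs')
  -- At a point of maximal distance from the origin the position is normal to the curve, so the
  -- distance there equals `|h|`.
  have hd : HasDerivAt Q (2 * tangential x y a b p r v * g v) v :=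
    (((H.deriv_support p r v).pow 2).add ((H.deriv_tangential p r v).pow 2)).congr_deriv
      (by push_cast; ring)
  have h0 := IsLocalMax.hasDerivAt_eq_zero (Filter.Eventually.of_forall hmax) hd
  have h1 : tangential x y a b p r v = 0 := by
    have := H.g_pos v
    simpa [this.ne'] using h0
  refine (hmax u).trans ?_
  simp only [hQ, h1]
  rw [← sq_abs (support x y a b p r v)]
  have := pow_le_pow_left₀ (abs_nonneg _) (h v) 2
  linarith

/-- The curve is compared with the point of the circle having the same outer normal `(b, -a)`. The
squared distance is `h² + q² - 2 R h + R²`, and `h² + q² ≤ (R + ε)²` while `h ≥ R - ε`. -/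
lemma dist_sq_circle_le (H : ConvexFrame x y a b g w) {p r R ε : ℝ} (hR : 0 ≤ R)
    (h : ∀ u, |support x y a b p r u - R| ≤ ε) (u : ℝ) :
    (x u - (p + R * b u)) ^ 2 + (y u - (r - R * a u)) ^ 2 ≤ 4 * R * ε + ε ^ 2 := by
  have h1 := H.sq_add_sq_le (p := p) (r := r) (M := R + ε) (fun v => by
    have h2 := abs_le.1 (h v)
    exact abs_le.2 ⟨by linarith, by linarith⟩) u
  have h2 := abs_le.1 (h u)
  have e : (x u - (p + R * b u)) ^ 2 + (y u - (r - R * a u)) ^ 2 =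
      support x y a b p r u ^ 2 + tangential x y a b p r u ^ 2 - 2 * R * support x y a b p r u +
      R ^ 2 := by
    simp only [support, tangential]
    linear_combination (R ^ 2 - (x u - p) ^ 2 - (y u - r) ^ 2) * H.unit u
  rw [e]
  nlinarith

lemma exists_tangent_eq (H : ConvexFrame x y a b g w) {s t : ℝ} (h : s ^ 2 + t ^ 2 = 1) :
    ∃ u, a u = s ∧ b u = t := by
  have h0 := H.unit 0
  -- `φ` is the angle from the initial tangent to the required direction, obtained as the argument
  -- of a quotient of unit complex numbers.
  obtain ⟨φ, h1, h2⟩ : ∃ φ : ℝ, Real.cos φ = a 0 * s + b 0 * t ∧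
      Real.sin φ = a 0 * t - b 0 * s := by
    have hn : ‖(⟨a 0 * s + b 0 * t, a 0 * t - b 0 * s⟩ : ℂ)‖ = 1 := by
      rw [Complex.norm_def, Complex.normSq_mk, Real.sqrt_eq_one]
      linear_combination (s ^ 2 + t ^ 2) * h0 + h
    refine ⟨Complex.arg ⟨a 0 * s + b 0 * t, a 0 * t - b 0 * s⟩, ?_, ?_⟩
    · rw [Complex.cos_arg (norm_ne_zero_iff.1 (by rw [hn]; exact one_ne_zero)), hn, div_one]
    · rw [Complex.sin_arg, hn, div_one]
  obtain ⟨u, hu⟩ := H.angle_surjective φ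
  obtain ⟨h3, h4⟩ := rotation_of_angle H.deriv_a H.deriv_b H.w_cont u
  rw [hu, h1, h2] at h3 h4
  refine ⟨u, ?_, ?_⟩
  · rw [h3]; linear_combination s * h0
  · rw [h4]; linear_combination t * h0

end ConvexFrame

end CurveFlow

namespace CurveFlow

/-! ### Partial derivatives and parametric integrals on a strip -/

/-- The derivative with respect to the first variable. -/
noncomputable def du (f : ℝ × ℝ → ℝ) (p : ℝ × ℝ) : ℝ := deriv (fun v => f (v, p.2)) p.1

/-- The derivative with respect to the second variable. -/
noncomputable def dt (f : ℝ × ℝ → ℝ) (p : ℝ × ℝ) : ℝ := deriv (fun τ => f (p.1, τ)) p.2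

variable {f : ℝ × ℝ → ℝ} {I J : Set ℝ} {u t : ℝ}

/-- The strip has no boundary in the first direction, so the derivative within it gives a two-sided
partial derivative. This keeps `du f` smooth up to the initial time, whereas `dt f` is only used on
open time sets. -/
lemma hasDerivAt_fderivWithin_fst (hf : ContDiffOn ℝ ∞ f (univ ×ˢ I)) (ht : t ∈ I) (u : ℝ) :
    HasDerivAt (fun v => f (v, t)) (fderivWithin ℝ f (univ ×ˢ I) (u, t) (1, 0)) u := by
  have hp : (u, t) ∈ (univ : Set ℝ) ×ˢ I := ⟨mem_univ _, ht⟩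
  have h1 : HasFDerivWithinAt f (fderivWithin ℝ f (univ ×ˢ I) (u, t)) (univ ×ˢ I) (u, t) :=
    ((hf.differentiableOn (by simp)) _ hp).hasFDerivWithinAt
  have h2 : HasDerivWithinAt (fun v : ℝ => (v, t)) ((1 : ℝ), (0 : ℝ)) univ u :=
    ((hasDerivAt_id u).prodMk (hasDerivAt_const u t)).hasDerivWithinAt
  have h3 := h1.comp_hasDerivWithinAt u h2 (fun v _ => mk_mem_prod (mem_univ v) ht)
  exact hasDerivWithinAt_univ.1 h3

lemma hasDerivAt_du (hf : ContDiffOn ℝ ∞ f (univ ×ˢ I)) (ht : t ∈ I) (u : ℝ) :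
    HasDerivAt (fun v => f (v, t)) (du f (u, t)) u :=
  (hasDerivAt_fderivWithin_fst hf ht u).differentiableAt.hasDerivAt

lemma contDiffOn_du (hI : UniqueDiffOn ℝ I) (hf : ContDiffOn ℝ ∞ f (univ ×ˢ I)) :
    ContDiffOn ℝ ∞ (du f) (univ ×ˢ I) := by
  have h1 : ContDiffOn ℝ ∞ (fun p => fderivWithin ℝ f (univ ×ˢ I) p (1, 0)) (univ ×ˢ I) :=
    (hf.fderivWithin (uniqueDiffOn_univ.prod hI) (by simp)).clm_apply contDiffOn_const
  refine h1.congr fun p hp => ?_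
  exact (hasDerivAt_fderivWithin_fst hf hp.2 p.1).deriv

lemma isOpen_strip (hJ : IsOpen J) : IsOpen ((univ : Set ℝ) ×ˢ J) := isOpen_univ.prod hJ

lemma hasDerivAt_fderiv_snd (hJ : IsOpen J) (hf : ContDiffOn ℝ ∞ f (univ ×ˢ J)) (ht : t ∈ J)
    (u : ℝ) : HasDerivAt (fun τ => f (u, τ)) (fderiv ℝ f (u, t) (0, 1)) t := by
  have hp : (univ : Set ℝ) ×ˢ J ∈ 𝓝 (u, t) := (isOpen_strip hJ).mem_nhds ⟨mem_univ _, ht⟩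
  have h1 : HasFDerivAt f (fderiv ℝ f (u, t)) (u, t) :=
    ((hf.contDiffAt hp).differentiableAt (by simp)).hasFDerivAt
  have h2 : HasDerivAt (fun τ : ℝ => (u, τ)) ((0 : ℝ), (1 : ℝ)) t :=
    (hasDerivAt_const t u).prodMk (hasDerivAt_id t)
  exact h1.comp_hasDerivAt t h2

lemma hasDerivAt_dt (hJ : IsOpen J) (hf : ContDiffOn ℝ ∞ f (univ ×ˢ J)) (ht : t ∈ J) (u : ℝ) :
    HasDerivAt (fun τ => f (u, τ)) (dt f (u, t)) t :=
  (hasDerivAt_fderiv_snd hJ hf ht u).differentiableAt.hasDerivAt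

lemma contDiffOn_fderiv_apply (hJ : IsOpen J) (hf : ContDiffOn ℝ ∞ f (univ ×ˢ J)) (v : ℝ × ℝ) :
    ContDiffOn ℝ ∞ (fun p => fderiv ℝ f p v) (univ ×ˢ J) :=
  (hf.fderiv_of_isOpen (isOpen_strip hJ) (by simp)).clm_apply contDiffOn_const

lemma contDiffOn_dt (hJ : IsOpen J) (hf : ContDiffOn ℝ ∞ f (univ ×ˢ J)) :
    ContDiffOn ℝ ∞ (dt f) (univ ×ˢ J) :=
  (contDiffOn_fderiv_apply hJ hf (0, 1)).congr fun p hp =>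
    (hasDerivAt_fderiv_snd hJ hf hp.2 p.1).deriv

lemma hasDerivAt_fderiv_fst (hJ : IsOpen J) (hf : ContDiffOn ℝ ∞ f (univ ×ˢ J)) (ht : t ∈ J)
    (u : ℝ) : HasDerivAt (fun v => f (v, t)) (fderiv ℝ f (u, t) (1, 0)) u := by
  have := hasDerivAt_fderivWithin_fst hf ht u
  rwa [fderivWithin_of_isOpen (isOpen_strip hJ) ⟨mem_univ _, ht⟩] at this

/-- Partial derivatives commute. -/
lemma dt_du_eq_du_dt (hJ : IsOpen J) (hf : ContDiffOn ℝ ∞ f (univ ×ˢ J)) (ht : t ∈ J) (u : ℝ) :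
    dt (du f) (u, t) = du (dt f) (u, t) := by
  have hp : (univ : Set ℝ) ×ˢ J ∈ 𝓝 (u, t) := (isOpen_strip hJ).mem_nhds ⟨mem_univ _, ht⟩
  have hd : DifferentiableAt ℝ (fderiv ℝ f) (u, t) :=
    ((hf.fderiv_of_isOpen (isOpen_strip hJ) (m := ∞) (by simp)).contDiffAt hp).differentiableAt
      (by simp)
  have hv : ∀ v w : ℝ × ℝ, fderiv ℝ (fun p => fderiv ℝ f p v) (u, t) w =
      fderiv ℝ (fderiv ℝ f) (u, t) w v := fun v w => by
    rw [fderiv_clm_apply hd (differentiableAt_const v)]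
    simp
  have h1 : dt (du f) (u, t) = fderiv ℝ (fderiv ℝ f) (u, t) (0, 1) (1, 0) := by
    rw [← hv]
    refine (HasDerivAt.congr_of_eventuallyEq
      (hasDerivAt_fderiv_snd hJ (contDiffOn_fderiv_apply hJ hf (1, 0)) ht u) ?_).deriv
    filter_upwards [hJ.mem_nhds ht] with τ hτ
    exact (hasDerivAt_fderiv_fst hJ hf hτ u).deriv
  have h2 : du (dt f) (u, t) = fderiv ℝ (fderiv ℝ f) (u, t) (1, 0) (0, 1) := by
    rw [← hv]
    refine (HasDerivAt.congr_of_eventuallyEq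
      (hasDerivAt_fderiv_fst hJ (contDiffOn_fderiv_apply hJ hf (0, 1)) ht u) ?_).deriv
    exact Filter.Eventually.of_forall fun v => (hasDerivAt_fderiv_snd hJ hf ht v).deriv
  rw [h1, h2]
  exact ((hf.contDiffAt hp).isSymmSndFDerivAt
    (by simpa using (ENat.LEInfty.out : (2 : WithTop ℕ∞) ≤ ∞))).eq _ _

lemma continuous_slice (hf : ContinuousOn f (univ ×ˢ I)) (ht : t ∈ I) :
    Continuous fun u => f (u, t) :=
  hf.comp_continuous (by fun_prop) fun u => ⟨mem_univ _, ht⟩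

lemma continuousOn_integral (hf : ContinuousOn f (univ ×ˢ I)) :
    ContinuousOn (fun t => ∫ u in (0 : ℝ)..(2 * Real.pi), f (u, t)) I := by
  rw [continuousOn_iff_continuous_domRestrict]
  refine intervalIntegral.continuous_parametric_intervalIntegral_of_continuous'
    (f := fun (s : I) u => f (u, s)) ?_ 0 (2 * Real.pi)
  exact hf.comp_continuous (by fun_prop) fun p => ⟨mem_univ _, p.1.2⟩

/-- Differentiation under the integral sign. -/
lemma hasDerivAt_integral (hJ : IsOpen J) (hf : ContDiffOn ℝ ∞ f (univ ×ˢ J)) (ht : t ∈ J) :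
    HasDerivAt (fun τ => ∫ u in (0 : ℝ)..(2 * Real.pi), f (u, τ))
      (∫ u in (0 : ℝ)..(2 * Real.pi), dt f (u, t)) t := by
  obtain ⟨ε, hε, hball⟩ := Metric.nhds_basis_closedBall.mem_iff.1 (hJ.mem_nhds ht)
  have hd := (contDiffOn_dt hJ hf).continuousOn
  have hK : IsCompact (Icc 0 (2 * Real.pi) ×ˢ Metric.closedBall t ε) :=
    isCompact_Icc.prod (isCompact_closedBall t ε)
  obtain ⟨C, hC⟩ := hK.exists_bound_of_continuousOn
    (hd.mono (prod_mono (subset_univ _) hball))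
  refine (intervalIntegral.hasDerivAt_integral_of_dominated_loc_of_deriv_le
    (F := fun τ u => f (u, τ)) (F' := fun τ u => dt f (u, τ)) (bound := fun _ => C)
    (Metric.closedBall_mem_nhds t hε) ?_ ?_ ?_ ?_ ?_ ?_).2
  · filter_upwards [hJ.mem_nhds ht] with τ hτ
    exact (continuous_slice hf.continuousOn hτ).aestronglyMeasurable
  · exact (continuous_slice hf.continuousOn ht).intervalIntegrable _ _
  · exact (continuous_slice hd ht).aestronglyMeasurable
  · refine Filter.Eventually.of_forall fun u hu τ hτ => hC (u, τ) ⟨?_, hτ⟩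
    rw [uIoc_of_le Real.two_pi_pos.le] at hu
    exact Ioc_subset_Icc_self hu
  · exact continuous_const.intervalIntegrable _ _
  · exact Filter.Eventually.of_forall fun u hu τ hτ => hasDerivAt_dt hJ hf (hball hτ) u

lemma periodic_dt (hJ : IsOpen J) (hp : ∀ t ∈ J, Function.Periodic (fun u => f (u, t)) (2 * Real.pi))
    (ht : t ∈ J) : Function.Periodic (fun u => dt f (u, t)) (2 * Real.pi) := fun u => by
  refine Filter.EventuallyEq.deriv_eq ?_
  filter_upwards [hJ.mem_nhds ht] with τ hτ
  exact hp τ hτ u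

lemma periodic_du (hp : Function.Periodic (fun u => f (u, t)) (2 * Real.pi)) :
    Function.Periodic (fun u => du f (u, t)) (2 * Real.pi) := fun u => by
  simp only [du]
  rw [← deriv_comp_add_const (f := fun v => f (v, t))]
  congr 1
  exact funext fun v => hp v

end CurveFlow

namespace CurveFlow

/-! ### Smooth families of closed curves in coordinates -/

/-- The speed of the curves `u ↦ (x, y)(u, t)`. -/
noncomputable def speed (x y : ℝ × ℝ → ℝ) (p : ℝ × ℝ) : ℝ := √(du x p ^ 2 + du y p ^ 2)

/-- The component `du f / |γ_u|` of the unit tangent. -/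
noncomputable def unitComp (x y f : ℝ × ℝ → ℝ) (p : ℝ × ℝ) : ℝ := du f p / speed x y p

/-- The `u`-derivative of the direction angle. -/
noncomputable def turn (x y : ℝ × ℝ → ℝ) (p : ℝ × ℝ) : ℝ :=
  unitComp x y x p * du (unitComp x y y) p - unitComp x y y p * du (unitComp x y x) p

/-- A smooth family of regular closed curves, in coordinates. -/
structure CurveFamily (I : Set ℝ) (x y : ℝ × ℝ → ℝ) : Prop where
  smooth_x : ContDiffOn ℝ ∞ x (univ ×ˢ I)
  smooth_y : ContDiffOn ℝ ∞ y (univ ×ˢ I)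
  per_x : ∀ t ∈ I, Function.Periodic (fun u => x (u, t)) (2 * Real.pi)
  per_y : ∀ t ∈ I, Function.Periodic (fun u => y (u, t)) (2 * Real.pi)
  regular : ∀ t ∈ I, ∀ u, 0 < du x (u, t) ^ 2 + du y (u, t) ^ 2

namespace CurveFamily

variable {x y : ℝ × ℝ → ℝ} {I J : Set ℝ} {t : ℝ}

lemma mono (H : CurveFamily I x y) (h : J ⊆ I) : CurveFamily J x y where
  smooth_x := H.smooth_x.mono (prod_mono_right h)
  smooth_y := H.smooth_y.mono (prod_mono_right h)
  per_x t ht := H.per_x t (h ht)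
  per_y t ht := H.per_y t (h ht)
  regular t ht := H.regular t (h ht)

lemma speed_pos (H : CurveFamily I x y) (ht : t ∈ I) (u : ℝ) : 0 < speed x y (u, t) :=
  Real.sqrt_pos.2 (H.regular t ht u)

lemma speed_sq (H : CurveFamily I x y) (ht : t ∈ I) (u : ℝ) :
    speed x y (u, t) ^ 2 = du x (u, t) ^ 2 + du y (u, t) ^ 2 :=
  Real.sq_sqrt (H.regular t ht u).le

lemma smooth_speed (H : CurveFamily I x y) (hI : UniqueDiffOn ℝ I) :
    ContDiffOn ℝ ∞ (speed x y) (univ ×ˢ I) :=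
  (((contDiffOn_du hI H.smooth_x).pow 2).add ((contDiffOn_du hI H.smooth_y).pow 2)).sqrt
    fun p hp => (H.regular p.2 hp.2 p.1).ne'

lemma smooth_unitComp (H : CurveFamily I x y) (hI : UniqueDiffOn ℝ I) {f : ℝ × ℝ → ℝ}
    (hf : ContDiffOn ℝ ∞ f (univ ×ˢ I)) : ContDiffOn ℝ ∞ (unitComp x y f) (univ ×ˢ I) :=
  (contDiffOn_du hI hf).div (H.smooth_speed hI) fun p hp => (H.speed_pos hp.2 p.1).ne'

lemma smooth_a (H : CurveFamily I x y) (hI : UniqueDiffOn ℝ I) :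
    ContDiffOn ℝ ∞ (unitComp x y x) (univ ×ˢ I) := H.smooth_unitComp hI H.smooth_x

lemma smooth_b (H : CurveFamily I x y) (hI : UniqueDiffOn ℝ I) :
    ContDiffOn ℝ ∞ (unitComp x y y) (univ ×ˢ I) := H.smooth_unitComp hI H.smooth_y

lemma smooth_turn (H : CurveFamily I x y) (hI : UniqueDiffOn ℝ I) :
    ContDiffOn ℝ ∞ (turn x y) (univ ×ˢ I) :=
  ((H.smooth_a hI).mul (contDiffOn_du hI (H.smooth_b hI))).sub
    ((H.smooth_b hI).mul (contDiffOn_du hI (H.smooth_a hI)))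

lemma speed_mul_unitComp (H : CurveFamily I x y) (ht : t ∈ I) (f : ℝ × ℝ → ℝ) (u : ℝ) :
    speed x y (u, t) * unitComp x y f (u, t) = du f (u, t) :=
  mul_div_cancel₀ _ (H.speed_pos ht u).ne'

lemma unit (H : CurveFamily I x y) (ht : t ∈ I) (u : ℝ) :
    unitComp x y x (u, t) ^ 2 + unitComp x y y (u, t) ^ 2 = 1 := by
  rw [unitComp, unitComp, div_pow, div_pow, ← add_div, ← H.speed_sq ht,
    div_self (pow_ne_zero 2 (H.speed_pos ht u).ne')]

lemma unit_deriv {f k : ℝ → ℝ} {f' k' s : ℝ} (hf : HasDerivAt f f' s) (hk : HasDerivAt k k' s)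
    (h : ∀ᶠ v in 𝓝 s, f v ^ 2 + k v ^ 2 = 1) : f s * f' + k s * k' = 0 := by
  have h1 := ((hf.pow 2).add (hk.pow 2)).congr_of_eventuallyEq
    (f₁ := fun _ => (1 : ℝ)) (h.mono fun v hv => hv.symm)
  have h2 := h1.unique (hasDerivAt_const s (1 : ℝ))
  push_cast at h2
  simp only [pow_one] at h2
  linarith

lemma unit_du (H : CurveFamily I x y) (hI : UniqueDiffOn ℝ I) (ht : t ∈ I) (u : ℝ) :
    unitComp x y x (u, t) * du (unitComp x y x) (u, t) +
      unitComp x y y (u, t) * du (unitComp x y y) (u, t) = 0 :=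
  unit_deriv (f := fun v => unitComp x y x (v, t)) (k := fun v => unitComp x y y (v, t))
    (s := u) (hasDerivAt_du (H.smooth_a hI) ht u) (hasDerivAt_du (H.smooth_b hI) ht u)
    (Filter.Eventually.of_forall fun v => H.unit ht v)

lemma unit_dt (H : CurveFamily J x y) (hJ : IsOpen J) (ht : t ∈ J) (u : ℝ) :
    unitComp x y x (u, t) * dt (unitComp x y x) (u, t) +
      unitComp x y y (u, t) * dt (unitComp x y y) (u, t) = 0 :=
  unit_deriv (f := fun τ => unitComp x y x (u, τ)) (k := fun τ => unitComp x y y (u, τ))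
    (s := t) (hasDerivAt_dt hJ (H.smooth_a hJ.uniqueDiffOn) ht u)
    (hasDerivAt_dt hJ (H.smooth_b hJ.uniqueDiffOn) ht u)
    (Filter.mem_of_superset (hJ.mem_nhds ht) fun _ hτ => H.unit hτ u)

/-- Frenet's equation: the derivative of a unit vector is orthogonal to it, and `turn` is its
component along the normal. -/
lemma du_a (H : CurveFamily I x y) (hI : UniqueDiffOn ℝ I) (ht : t ∈ I) (u : ℝ) :
    du (unitComp x y x) (u, t) = -(turn x y (u, t) * unitComp x y y (u, t)) := by
  simp only [turn]
  linear_combination (-(du (unitComp x y x) (u, t))) * H.unit ht u +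
    unitComp x y x (u, t) * H.unit_du hI ht u

lemma du_b (H : CurveFamily I x y) (hI : UniqueDiffOn ℝ I) (ht : t ∈ I) (u : ℝ) :
    du (unitComp x y y) (u, t) = turn x y (u, t) * unitComp x y x (u, t) := by
  simp only [turn]
  linear_combination (-(du (unitComp x y y) (u, t))) * H.unit ht u +
    unitComp x y y (u, t) * H.unit_du hI ht u

lemma deriv_x (H : CurveFamily I x y) (ht : t ∈ I) (u : ℝ) :
    HasDerivAt (fun v => x (v, t)) (speed x y (u, t) * unitComp x y x (u, t)) u := by
  rw [H.speed_mul_unitComp ht]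
  exact hasDerivAt_du H.smooth_x ht u

lemma deriv_y (H : CurveFamily I x y) (ht : t ∈ I) (u : ℝ) :
    HasDerivAt (fun v => y (v, t)) (speed x y (u, t) * unitComp x y y (u, t)) u := by
  rw [H.speed_mul_unitComp ht]
  exact hasDerivAt_du H.smooth_y ht u

lemma deriv_a (H : CurveFamily I x y) (hI : UniqueDiffOn ℝ I) (ht : t ∈ I) (u : ℝ) :
    HasDerivAt (fun v => unitComp x y x (v, t))
      (-(turn x y (u, t) * unitComp x y y (u, t))) u := by
  rw [← H.du_a hI ht]
  exact hasDerivAt_du (H.smooth_a hI) ht u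

lemma deriv_b (H : CurveFamily I x y) (hI : UniqueDiffOn ℝ I) (ht : t ∈ I) (u : ℝ) :
    HasDerivAt (fun v => unitComp x y y (v, t)) (turn x y (u, t) * unitComp x y x (u, t)) u := by
  rw [← H.du_b hI ht]
  exact hasDerivAt_du (H.smooth_b hI) ht u

lemma per_speed (H : CurveFamily I x y) (ht : t ∈ I) :
    Function.Periodic (fun u => speed x y (u, t)) (2 * Real.pi) := fun u => by
  have h1 := periodic_du (H.per_x t ht) u
  have h2 := periodic_du (H.per_y t ht) u
  simp only at h1 h2
  simp only [speed, h1, h2]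

lemma per_a (H : CurveFamily I x y) (ht : t ∈ I) :
    Function.Periodic (fun u => unitComp x y x (u, t)) (2 * Real.pi) := fun u => by
  have h1 := periodic_du (H.per_x t ht) u
  have h2 := H.per_speed ht u
  simp only at h1 h2
  simp only [unitComp, h1, h2]

lemma per_b (H : CurveFamily I x y) (ht : t ∈ I) :
    Function.Periodic (fun u => unitComp x y y (u, t)) (2 * Real.pi) := fun u => by
  have h1 := periodic_du (H.per_y t ht) u
  have h2 := H.per_speed ht u
  simp only at h1 h2
  simp only [unitComp, h1, h2]

lemma per_turn (H : CurveFamily I x y) (ht : t ∈ I) :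
    Function.Periodic (fun u => turn x y (u, t)) (2 * Real.pi) := fun u => by
  have h1 := periodic_du (H.per_a ht) u
  have h2 := periodic_du (H.per_b ht) u
  have h3 := H.per_a ht u
  have h4 := H.per_b ht u
  simp only at h1 h2 h3 h4
  simp only [turn, h1, h2, h3, h4]

lemma convexFrame (H : CurveFamily I x y) (hI : UniqueDiffOn ℝ I) (ht : t ∈ I)
    (hw : ∀ u, 0 < turn x y (u, t))
    (htotal : ∫ u in (0 : ℝ)..(2 * Real.pi), turn x y (u, t) = 2 * Real.pi) :
    ConvexFrame (fun u => x (u, t)) (fun u => y (u, t)) (fun u => unitComp x y x (u, t))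
      (fun u => unitComp x y y (u, t)) (fun u => speed x y (u, t)) (fun u => turn x y (u, t)) where
  deriv_x := H.deriv_x ht
  deriv_y := H.deriv_y ht
  deriv_a := H.deriv_a hI ht
  deriv_b := H.deriv_b hI ht
  unit := H.unit ht
  g_pos := H.speed_pos ht
  w_pos := hw
  g_cont := continuous_slice (H.smooth_speed hI).continuousOn ht
  w_cont := continuous_slice (H.smooth_turn hI).continuousOn ht
  x_per := H.per_x t ht
  y_per := H.per_y t ht
  a_per := H.per_a ht
  b_per := H.per_b ht
  g_per := H.per_speed ht
  w_per := H.per_turn ht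
  total := htotal

/-! ### Evolution of length, area, total turning and Steiner point -/

/-- The normal velocity. -/
noncomputable def normalSpeed (x y : ℝ × ℝ → ℝ) (p : ℝ × ℝ) : ℝ :=
  unitComp x y x p * dt y p - unitComp x y y p * dt x p

/-- Integration by parts over the circle. In each variation formula below, `P` collects the terms
that form a total `u`-derivative; the tangential velocity disappears with them. -/
lemma integral_eq_of_hasDerivAt {f k P : ℝ → ℝ} (hf : Continuous f) (hk : Continuous k)
    (hP : ∀ u, HasDerivAt P (f u - k u) u) (hper : Function.Periodic P (2 * Real.pi)) :
    ∫ u in (0 : ℝ)..(2 * Real.pi), f u = ∫ u in (0 : ℝ)..(2 * Real.pi), k u := by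
  have h := ConvexFrame.integral_deriv_eq_zero hP hper (hf.sub hk)
  rw [intervalIntegral.integral_sub (hf.intervalIntegrable _ _) (hk.intervalIntegrable _ _)] at h
  linarith

lemma smooth_normalSpeed (H : CurveFamily J x y) (hJ : IsOpen J) :
    ContDiffOn ℝ ∞ (normalSpeed x y) (univ ×ˢ J) :=
  ((H.smooth_a hJ.uniqueDiffOn).mul (contDiffOn_dt hJ H.smooth_y)).sub
    ((H.smooth_b hJ.uniqueDiffOn).mul (contDiffOn_dt hJ H.smooth_x))

lemma dt_speed (H : CurveFamily J x y) (hJ : IsOpen J) (ht : t ∈ J) (u : ℝ) :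
    dt (speed x y) (u, t) = unitComp x y x (u, t) * du (dt x) (u, t) +
      unitComp x y y (u, t) * du (dt y) (u, t) := by
  have hU := hJ.uniqueDiffOn (𝕜 := ℝ)
  have h1 := hasDerivAt_dt hJ (contDiffOn_du hU H.smooth_x) ht u
  have h2 := hasDerivAt_dt hJ (contDiffOn_du hU H.smooth_y) ht u
  have h3 := ((h1.pow 2).add (h2.pow 2)).sqrt (H.regular t ht u).ne'
  refine h3.deriv.trans ?_
  rw [← dt_du_eq_du_dt hJ H.smooth_x ht, ← dt_du_eq_du_dt hJ H.smooth_y ht]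
  simp only [unitComp, Pi.add_apply, Pi.pow_apply]
  change _ / (2 * speed x y (u, t)) = _
  have := H.speed_pos ht u
  field_simp
  push_cast
  ring

lemma per_dt_x (H : CurveFamily J x y) (hJ : IsOpen J) (ht : t ∈ J) :
    Function.Periodic (fun u => dt x (u, t)) (2 * Real.pi) := periodic_dt hJ H.per_x ht

lemma per_dt_y (H : CurveFamily J x y) (hJ : IsOpen J) (ht : t ∈ J) :
    Function.Periodic (fun u => dt y (u, t)) (2 * Real.pi) := periodic_dt hJ H.per_y ht

lemma per_dt_a (H : CurveFamily J x y) (hJ : IsOpen J) (ht : t ∈ J) :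
    Function.Periodic (fun u => dt (unitComp x y x) (u, t)) (2 * Real.pi) :=
  periodic_dt hJ (fun _ => H.per_a) ht

lemma per_dt_b (H : CurveFamily J x y) (hJ : IsOpen J) (ht : t ∈ J) :
    Function.Periodic (fun u => dt (unitComp x y y) (u, t)) (2 * Real.pi) :=
  periodic_dt hJ (fun _ => H.per_b) ht

/-- Both derivatives of the unit tangent are orthogonal to it, hence parallel to each other. -/
lemma cross_dt_du (H : CurveFamily J x y) (hJ : IsOpen J) (ht : t ∈ J) (u : ℝ) :
    dt (unitComp x y x) (u, t) * du (unitComp x y y) (u, t) -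
      dt (unitComp x y y) (u, t) * du (unitComp x y x) (u, t) = 0 := by
  have h1 := H.unit ht u
  have h2 := H.unit_dt hJ ht u
  rw [H.du_a hJ.uniqueDiffOn ht, H.du_b hJ.uniqueDiffOn ht]
  linear_combination turn x y (u, t) * h2

/-- First variation of length: `g_t = ⟨T, X_tu⟩` differs from `-w F` by the `u`-derivative of `⟨T,
X_t⟩`. -/
theorem hasDerivAt_length (H : CurveFamily J x y) (hJ : IsOpen J) (ht : t ∈ J) :
    HasDerivAt (fun τ => ∫ u in (0 : ℝ)..(2 * Real.pi), speed x y (u, τ))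
      (∫ u in (0 : ℝ)..(2 * Real.pi), -(turn x y (u, t) * normalSpeed x y (u, t))) t := by
  have hU := hJ.uniqueDiffOn (𝕜 := ℝ)
  have hV := contDiffOn_dt hJ H.smooth_x
  have hW := contDiffOn_dt hJ H.smooth_y
  refine (hasDerivAt_integral hJ (H.smooth_speed hU) ht).congr_deriv ?_
  refine integral_eq_of_hasDerivAt
    (P := fun u => unitComp x y x (u, t) * dt x (u, t) + unitComp x y y (u, t) * dt y (u, t))
    (continuous_slice (contDiffOn_dt hJ (H.smooth_speed hU)).continuousOn ht)
    (continuous_slice ((H.smooth_turn hU).mul (H.smooth_normalSpeed hJ)).continuousOn ht).neg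
    (fun u => ?_) (((H.per_a ht).mul (H.per_dt_x hJ ht)).add
      ((H.per_b ht).mul (H.per_dt_y hJ ht)))
  refine (((H.deriv_a hU ht u).mul (hasDerivAt_du hV ht u)).add
    ((H.deriv_b hU ht u).mul (hasDerivAt_du hW ht u))).congr_deriv ?_
  rw [H.dt_speed hJ ht, normalSpeed]
  ring

/-- Twice the area form. -/
noncomputable def areaForm (x y : ℝ × ℝ → ℝ) (p : ℝ × ℝ) : ℝ := x p * du y p - y p * du x p

lemma smooth_areaForm (H : CurveFamily I x y) (hI : UniqueDiffOn ℝ I) :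
    ContDiffOn ℝ ∞ (areaForm x y) (univ ×ˢ I) :=
  (H.smooth_x.mul (contDiffOn_du hI H.smooth_y)).sub
    (H.smooth_y.mul (contDiffOn_du hI H.smooth_x))

theorem hasDerivAt_area (H : CurveFamily J x y) (hJ : IsOpen J) (ht : t ∈ J) :
    HasDerivAt (fun τ => ∫ u in (0 : ℝ)..(2 * Real.pi), areaForm x y (u, τ))
      (∫ u in (0 : ℝ)..(2 * Real.pi), -2 * (speed x y (u, t) * normalSpeed x y (u, t))) t := by
  have hU := hJ.uniqueDiffOn (𝕜 := ℝ)
  have hV := contDiffOn_dt hJ H.smooth_x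
  have hW := contDiffOn_dt hJ H.smooth_y
  have hform := H.smooth_areaForm hU
  refine (hasDerivAt_integral hJ hform ht).congr_deriv ?_
  refine integral_eq_of_hasDerivAt
    (P := fun u => x (u, t) * dt y (u, t) - y (u, t) * dt x (u, t))
    (continuous_slice (contDiffOn_dt hJ hform).continuousOn ht)
    (continuous_const.mul (continuous_slice
      ((H.smooth_speed hU).mul (H.smooth_normalSpeed hJ)).continuousOn ht))
    (fun u => ?_) (((H.per_x t ht).mul (H.per_dt_y hJ ht)).sub
      ((H.per_y t ht).mul (H.per_dt_x hJ ht)))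
  refine (((hasDerivAt_du H.smooth_x ht u).mul (hasDerivAt_du hW ht u)).sub
    ((hasDerivAt_du H.smooth_y ht u).mul (hasDerivAt_du hV ht u))).congr_deriv ?_
  have h1 : dt (areaForm x y) (u, t) = _ :=
    (((hasDerivAt_dt hJ H.smooth_x ht u).mul
      (hasDerivAt_dt hJ (contDiffOn_du hU H.smooth_y) ht u)).sub
    ((hasDerivAt_dt hJ H.smooth_y ht u).mul
      (hasDerivAt_dt hJ (contDiffOn_du hU H.smooth_x) ht u))).deriv
  rw [h1, dt_du_eq_du_dt hJ H.smooth_x ht, dt_du_eq_du_dt hJ H.smooth_y ht, normalSpeed,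
    ← H.speed_mul_unitComp ht x, ← H.speed_mul_unitComp ht y]
  ring

/-- The time derivative of the integrand `⟨N, T_u⟩` is the `u`-derivative of `⟨N, T_t⟩`, up to a
multiple of the cross product of `T_t` and `T_u`, which vanishes. -/
theorem hasDerivAt_total_turn (H : CurveFamily J x y) (hJ : IsOpen J) (ht : t ∈ J) :
    HasDerivAt (fun τ => ∫ u in (0 : ℝ)..(2 * Real.pi), turn x y (u, τ)) 0 t := by
  have hU := hJ.uniqueDiffOn (𝕜 := ℝ)
  have ha := H.smooth_a hU
  have hb := H.smooth_b hU
  refine (hasDerivAt_integral hJ (H.smooth_turn hU) ht).congr_deriv ?_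
  refine Eq.trans (integral_eq_of_hasDerivAt (k := fun _ => 0)
    (P := fun u => unitComp x y x (u, t) * dt (unitComp x y y) (u, t) -
      unitComp x y y (u, t) * dt (unitComp x y x) (u, t))
    (continuous_slice (contDiffOn_dt hJ (H.smooth_turn hU)).continuousOn ht)
    continuous_const
    (fun u => ?_) (((H.per_a ht).mul (H.per_dt_b hJ ht)).sub
      ((H.per_b ht).mul (H.per_dt_a hJ ht)))) intervalIntegral.integral_zero
  refine (((hasDerivAt_du ha ht u).mul (hasDerivAt_du (contDiffOn_dt hJ hb) ht u)).sub
    ((hasDerivAt_du hb ht u).mul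
      (hasDerivAt_du (contDiffOn_dt hJ ha) ht u))).congr_deriv ?_
  have h1 : dt (turn x y) (u, t) = _ :=
    (((hasDerivAt_dt hJ ha ht u).mul
      (hasDerivAt_dt hJ (contDiffOn_du hU hb) ht u)).sub
    ((hasDerivAt_dt hJ hb ht u).mul
      (hasDerivAt_dt hJ (contDiffOn_du hU ha) ht u))).deriv
  rw [h1, dt_du_eq_du_dt hJ ha ht, dt_du_eq_du_dt hJ hb ht]
  linear_combination (-2) * H.cross_dt_du hJ ht u

/-- The integrand of the Steiner point. -/
noncomputable def steinerForm (x y f : ℝ × ℝ → ℝ) (p : ℝ × ℝ) : ℝ :=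
  (x p * unitComp x y y p - y p * unitComp x y x p) * du (unitComp x y f) p

lemma smooth_steinerForm (H : CurveFamily I x y) (hI : UniqueDiffOn ℝ I) {f : ℝ × ℝ → ℝ}
    (hf : ContDiffOn ℝ ∞ f (univ ×ˢ I)) : ContDiffOn ℝ ∞ (steinerForm x y f) (univ ×ˢ I) :=
  ((H.smooth_x.mul (H.smooth_b hI)).sub (H.smooth_y.mul (H.smooth_a hI))).mul
    (contDiffOn_du hI (H.smooth_unitComp hI hf))

/-- Here `f` stands for either coordinate, and `ha`, `hb` express that `T_t` and `T_u` are parallel.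
After the derivative of `h` times the `t`-derivative of the tangent component is split off, the
terms in which the tangent moves cancel and only `⟨X_t, N⟩` remains. -/
lemma hasDerivAt_steiner_aux (H : CurveFamily J x y) (hJ : IsOpen J) (ht : t ∈ J)
    {f : ℝ × ℝ → ℝ} (hf : ContDiffOn ℝ ∞ f (univ ×ˢ J))
    (hper : ∀ t ∈ J, Function.Periodic (fun u => unitComp x y f (u, t)) (2 * Real.pi))
    (ha : ∀ u, dt (unitComp x y f) (u, t) * du (unitComp x y x) (u, t) =
      dt (unitComp x y x) (u, t) * du (unitComp x y f) (u, t))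
    (hb : ∀ u, dt (unitComp x y f) (u, t) * du (unitComp x y y) (u, t) =
      dt (unitComp x y y) (u, t) * du (unitComp x y f) (u, t)) :
    HasDerivAt (fun τ => ∫ u in (0 : ℝ)..(2 * Real.pi), steinerForm x y f (u, τ))
      (∫ u in (0 : ℝ)..(2 * Real.pi),
        -(normalSpeed x y (u, t) * du (unitComp x y f) (u, t))) t := by
  have hU := hJ.uniqueDiffOn (𝕜 := ℝ)
  have hsa := H.smooth_a hU
  have hsb := H.smooth_b hU
  have hform := H.smooth_steinerForm hU hf
  have hsf := H.smooth_unitComp hU hf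
  refine (hasDerivAt_integral hJ hform ht).congr_deriv ?_
  refine integral_eq_of_hasDerivAt
    (P := fun u => (x (u, t) * unitComp x y y (u, t) - y (u, t) * unitComp x y x (u, t)) *
      dt (unitComp x y f) (u, t))
    (continuous_slice (contDiffOn_dt hJ hform).continuousOn ht)
    (continuous_slice ((H.smooth_normalSpeed hJ).mul (contDiffOn_du hU hsf)).continuousOn ht).neg
    (fun u => ?_) ((((H.per_x t ht).mul (H.per_b ht)).sub ((H.per_y t ht).mul (H.per_a ht))).mul
      (periodic_dt hJ hper ht))
  refine ((((hasDerivAt_du H.smooth_x ht u).mul (hasDerivAt_du hsb ht u)).sub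
    ((hasDerivAt_du H.smooth_y ht u).mul (hasDerivAt_du hsa ht u))).mul
      (hasDerivAt_du (contDiffOn_dt hJ hsf) ht u)).congr_deriv ?_
  have h1 : dt (steinerForm x y f) (u, t) = _ :=
    ((((hasDerivAt_dt hJ H.smooth_x ht u).mul (hasDerivAt_dt hJ hsb ht u)).sub
    ((hasDerivAt_dt hJ H.smooth_y ht u).mul (hasDerivAt_dt hJ hsa ht u))).mul
      (hasDerivAt_dt hJ (contDiffOn_du hU hsf) ht u)).deriv
  rw [h1, dt_du_eq_du_dt hJ hsf ht, normalSpeed, ← H.speed_mul_unitComp ht x,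
    ← H.speed_mul_unitComp ht y]
  simp only [Pi.sub_apply, Pi.mul_apply]
  linear_combination x (u, t) * hb u - y (u, t) * ha u

theorem hasDerivAt_steiner_x (H : CurveFamily J x y) (hJ : IsOpen J) (ht : t ∈ J) :
    HasDerivAt (fun τ => ∫ u in (0 : ℝ)..(2 * Real.pi), steinerForm x y x (u, τ))
      (∫ u in (0 : ℝ)..(2 * Real.pi),
        -(normalSpeed x y (u, t) * du (unitComp x y x) (u, t))) t :=
  H.hasDerivAt_steiner_aux hJ ht H.smooth_x (fun _ => H.per_a) (fun _ => rfl)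
    fun u => sub_eq_zero.1 (H.cross_dt_du hJ ht u)

theorem hasDerivAt_steiner_y (H : CurveFamily J x y) (hJ : IsOpen J) (ht : t ∈ J) :
    HasDerivAt (fun τ => ∫ u in (0 : ℝ)..(2 * Real.pi), steinerForm x y y (u, τ))
      (∫ u in (0 : ℝ)..(2 * Real.pi),
        -(normalSpeed x y (u, t) * du (unitComp x y y) (u, t))) t :=
  H.hasDerivAt_steiner_aux hJ ht H.smooth_y (fun _ => H.per_b)
    (fun u => (sub_eq_zero.1 (H.cross_dt_du hJ ht u)).symm) (fun _ => rfl)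

end CurveFamily

end CurveFlow

namespace CurveFlow

/-! ### Coordinates of a family of plane curves -/

/-- A coordinate of a family of plane curves. -/
def coord (X : ℝ → ℝ → Plane) (i : Fin 2) (p : ℝ × ℝ) : ℝ := X p.1 p.2 i

lemma HasDerivAt.plane_apply {γ : ℝ → Plane} {γ' : Plane} {u : ℝ} (h : HasDerivAt γ γ' u)
    (i : Fin 2) : HasDerivAt (fun v => γ v i) (γ' i) u :=
  (EuclideanSpace.proj i : Plane →L[ℝ] ℝ).hasFDerivAt.comp_hasDerivAt u h

lemma inner_plane (v w : Plane) : inner ℝ v w = v 0 * w 0 + v 1 * w 1 := by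
  simp [PiLp.inner_apply, Fin.sum_univ_two, mul_comm]

lemma norm_plane (v : Plane) : ‖v‖ = √(v 0 ^ 2 + v 1 ^ 2) := by
  simp [EuclideanSpace.norm_eq, Fin.sum_univ_two]

section Coordinates

variable {X : ℝ → ℝ → Plane} {I : Set ℝ} {t : ℝ}

lemma contDiffOn_coord (hX : ContDiffOn ℝ ∞ (fun p : ℝ × ℝ => X p.1 p.2) (univ ×ˢ I))
    (i : Fin 2) : ContDiffOn ℝ ∞ (coord X i) (univ ×ˢ I) :=
  (EuclideanSpace.proj i : Plane →L[ℝ] ℝ).contDiff.comp_contDiffOn hX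

lemma contDiff_slice (hX : ContDiffOn ℝ ∞ (fun p : ℝ × ℝ => X p.1 p.2) (univ ×ˢ I))
    (ht : t ∈ I) : ContDiff ℝ ∞ fun u => X u t := by
  rw [← contDiffOn_univ]
  exact hX.comp (g := fun p : ℝ × ℝ => X p.1 p.2) (f := fun u : ℝ => (u, t))
    (by fun_prop) fun u _ => mk_mem_prod (mem_univ u) ht

lemma deriv_slice_apply (hX : ContDiffOn ℝ ∞ (fun p : ℝ × ℝ => X p.1 p.2) (univ ×ˢ I))
    (ht : t ∈ I) (u : ℝ) (i : Fin 2) :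
    deriv (fun v => X v t) u i = du (coord X i) (u, t) :=
  (HasDerivAt.plane_apply (((contDiff_slice hX ht).differentiable (by simp)) u).hasDerivAt
    i).deriv.symm

lemma metric_slice (hX : ContDiffOn ℝ ∞ (fun p : ℝ × ℝ => X p.1 p.2) (univ ×ˢ I))
    (ht : t ∈ I) (u : ℝ) :
    metric (fun v => X v t) u = speed (coord X 0) (coord X 1) (u, t) := by
  rw [metric, norm_plane, deriv_slice_apply hX ht, deriv_slice_apply hX ht, speed]

lemma tangent_slice (hX : ContDiffOn ℝ ∞ (fun p : ℝ × ℝ => X p.1 p.2) (univ ×ˢ I))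
    (ht : t ∈ I) (u : ℝ) (i : Fin 2) :
    tangent (fun v => X v t) u i = unitComp (coord X 0) (coord X 1) (coord X i) (u, t) := by
  rw [tangent, PiLp.smul_apply, metric_slice hX ht, deriv_slice_apply hX ht, unitComp, smul_eq_mul,
    inv_mul_eq_div]

lemma normal_slice (hX : ContDiffOn ℝ ∞ (fun p : ℝ × ℝ => X p.1 p.2) (univ ×ˢ I))
    (ht : t ∈ I) (u : ℝ) :
    normal (fun v => X v t) u 0 = -unitComp (coord X 0) (coord X 1) (coord X 1) (u, t) ∧
      normal (fun v => X v t) u 1 = unitComp (coord X 0) (coord X 1) (coord X 0) (u, t) := by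
  rw [← tangent_slice hX ht, ← tangent_slice hX ht]
  simp [normal, rot]

lemma curvature_slice (hX : ContDiffOn ℝ ∞ (fun p : ℝ × ℝ => X p.1 p.2) (univ ×ˢ I))
    (H : CurveFamily I (coord X 0) (coord X 1)) (hI : UniqueDiffOn ℝ I)
    (ht : t ∈ I) (u : ℝ) : curvature (fun v => X v t) u =
      turn (coord X 0) (coord X 1) (u, t) / speed (coord X 0) (coord X 1) (u, t) := by
  have hd : DifferentiableAt ℝ (tangent fun v => X v t) u := by
    have hγ := contDiff_slice hX ht
    have h1 : Differentiable ℝ (deriv fun v => X v t) :=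
      ((contDiff_infty_iff_deriv.1 hγ).2).differentiable (by simp)
    have h2 : DifferentiableAt ℝ (metric fun v => X v t) u := by
      have : metric (fun v => X v t) = fun u => speed (coord X 0) (coord X 1) (u, t) :=
        funext fun u => metric_slice hX ht u
      rw [this]
      exact (hasDerivAt_du (H.smooth_speed hI) ht u).differentiableAt
    have h3 : metric (fun v => X v t) u ≠ 0 := by
      rw [metric_slice hX ht]
      exact (H.speed_pos ht u).ne'
    exact (h2.inv h3).smul (h1 u)
  have hi : ∀ i, deriv (tangent fun v => X v t) u i =
      du (unitComp (coord X 0) (coord X 1) (coord X i)) (u, t) := fun i => by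
    rw [← (HasDerivAt.plane_apply hd.hasDerivAt i).deriv]
    simp only [tangent_slice hX ht]
    rfl
  rw [curvature, inner_plane, PiLp.smul_apply, PiLp.smul_apply, (normal_slice hX ht u).1,
    (normal_slice hX ht u).2, hi, hi, metric_slice hX ht, turn, smul_eq_mul, smul_eq_mul]
  have := H.speed_pos ht u
  field_simp
  ring

lemma length_slice (hX : ContDiffOn ℝ ∞ (fun p : ℝ × ℝ => X p.1 p.2) (univ ×ˢ I))
    (ht : t ∈ I) : length (fun v => X v t) =
      ∫ u in (0 : ℝ)..(2 * Real.pi), speed (coord X 0) (coord X 1) (u, t) := by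
  simp only [length, metric_slice hX ht]

lemma area_slice (hX : ContDiffOn ℝ ∞ (fun p : ℝ × ℝ => X p.1 p.2) (univ ×ˢ I))
    (ht : t ∈ I) : area (fun v => X v t) = 1 / 2 *
      ∫ u in (0 : ℝ)..(2 * Real.pi), CurveFamily.areaForm (coord X 0) (coord X 1) (u, t) := by
  simp only [area, deriv_slice_apply hX ht]
  rfl

lemma nonlocalTerm_slice (hX : ContDiffOn ℝ ∞ (fun p : ℝ × ℝ => X p.1 p.2) (univ ×ˢ I))
    (H : CurveFamily I (coord X 0) (coord X 1)) (hI : UniqueDiffOn ℝ I)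
    (ht : t ∈ I) : nonlocalTerm (fun v => X v t) = 2 * Real.pi /
      ∫ u in (0 : ℝ)..(2 * Real.pi), speed (coord X 0) (coord X 1) (u, t) ^ 2 /
        turn (coord X 0) (coord X 1) (u, t) := by
  simp only [nonlocalTerm, curvature_slice hX H hI ht, metric_slice hX ht]
  congr 2
  ext u
  rw [one_div_div]
  ring

end Coordinates

/-! ### The time interval -/

lemma zero_mem_timeInterval {T : EReal} (hT : 0 < T) : (0 : ℝ) ∈ timeInterval T :=
  ⟨le_rfl, by exact_mod_cast hT⟩

lemma convex_timeInterval (T : EReal) : Convex ℝ (timeInterval T) := by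
  refine Set.OrdConnected.convex ⟨fun s hs t ht r hr => ⟨hs.1.trans hr.1, ?_⟩⟩
  exact (EReal.coe_le_coe_iff.2 hr.2).trans_lt ht.2

lemma interior_timeInterval_nonempty {T : EReal} (hT : 0 < T) :
    (interior (timeInterval T)).Nonempty := by
  obtain ⟨τ, h0, hτ⟩ := EReal.lt_iff_exists_real_btwn.1 hT
  have h0' : 0 < τ := by exact_mod_cast h0
  have hsub : Ioo 0 τ ⊆ timeInterval T := fun s hs =>
    ⟨hs.1.le, (EReal.coe_lt_coe_iff.2 hs.2).trans hτ⟩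
  exact (nonempty_Ioo.2 h0').mono (isOpen_Ioo.subset_interior_iff.2 hsub)

lemma uniqueDiffOn_timeInterval {T : EReal} (hT : 0 < T) : UniqueDiffOn ℝ (timeInterval T) :=
  uniqueDiffOn_convex (convex_timeInterval T) (interior_timeInterval_nonempty hT)

lemma timeInterval_top : timeInterval ⊤ = Ici 0 := by
  ext t
  simp [timeInterval]

end CurveFlow

namespace CurveFlow

/-! ### The flow in coordinates -/

/-- A solution of the flow, in coordinates. -/
structure CoordFlow (I : Set ℝ) (x y : ℝ × ℝ → ℝ) : Prop extends CurveFamily I x y where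
  convex : Convex ℝ I
  nonempty : (interior I).Nonempty
  turn_pos : ∀ t ∈ I, ∀ u, 0 < turn x y (u, t)
  total : ∀ t ∈ I, ∫ u in (0 : ℝ)..(2 * Real.pi), turn x y (u, t) = 2 * Real.pi
  normal_speed : ∀ t ∈ interior I, ∀ u, CurveFamily.normalSpeed x y (u, t) =
    turn x y (u, t) / speed x y (u, t) -
      2 * Real.pi / (∫ v in (0 : ℝ)..(2 * Real.pi), speed x y (v, t) ^ 2 / turn x y (v, t)) *
        (speed x y (u, t) / turn x y (u, t))

/-- The length as a function of time. -/
noncomputable def flowLength (x y : ℝ × ℝ → ℝ) (t : ℝ) : ℝ :=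
  ∫ u in (0 : ℝ)..(2 * Real.pi), speed x y (u, t)

/-- The area as a function of time. -/
noncomputable def flowArea (x y : ℝ × ℝ → ℝ) (t : ℝ) : ℝ :=
  1 / 2 * ∫ u in (0 : ℝ)..(2 * Real.pi), CurveFamily.areaForm x y (u, t)

/-- The Steiner point, up to the factor `-1 / π`. -/
noncomputable def flowSteiner (x y f : ℝ × ℝ → ℝ) (t : ℝ) : ℝ :=
  ∫ u in (0 : ℝ)..(2 * Real.pi), CurveFamily.steinerForm x y f (u, t)

lemma antitoneOn_of_hasDerivAt {f f' : ℝ → ℝ} {I : Set ℝ} (hI : Convex ℝ I)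
    (hc : ContinuousOn f I) (hd : ∀ t ∈ interior I, HasDerivAt f (f' t) t)
    (h : ∀ t ∈ interior I, f' t ≤ 0) : AntitoneOn f I :=
  antitoneOn_of_deriv_nonpos hI hc
    (fun t ht => (hd t ht).differentiableAt.differentiableWithinAt)
    fun t ht => by rw [(hd t ht).deriv]; exact h t ht

lemma monotoneOn_of_hasDerivAt {f f' : ℝ → ℝ} {I : Set ℝ} (hI : Convex ℝ I)
    (hc : ContinuousOn f I) (hd : ∀ t ∈ interior I, HasDerivAt f (f' t) t)
    (h : ∀ t ∈ interior I, 0 ≤ f' t) : MonotoneOn f I :=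
  monotoneOn_of_deriv_nonneg hI hc
    (fun t ht => (hd t ht).differentiableAt.differentiableWithinAt)
    fun t ht => by rw [(hd t ht).deriv]; exact h t ht

lemma eq_of_hasDerivAt_zero {f : ℝ → ℝ} {I : Set ℝ} (hI : Convex ℝ I)
    (hc : ContinuousOn f I) (hd : ∀ t ∈ interior I, HasDerivAt f 0 t) {s t : ℝ} (hs : s ∈ I)
    (ht : t ∈ I) : f s = f t := by
  have h1 := antitoneOn_of_hasDerivAt hI hc hd fun _ _ => le_rfl
  have h2 := monotoneOn_of_hasDerivAt hI hc hd fun _ _ => le_rfl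
  rcases le_total s t with h | h
  · exact le_antisymm (h2 hs ht h) (h1 hs ht h)
  · exact le_antisymm (h1 ht hs h) (h2 ht hs h)

/-- The total turning is preserved by any smooth deformation. -/
lemma CurveFamily.total_turn_eq {I : Set ℝ} {x y : ℝ × ℝ → ℝ} (H : CurveFamily I x y)
    (hI : Convex ℝ I) (hne : (interior I).Nonempty) {s t : ℝ} (hs : s ∈ I) (ht : t ∈ I) :
    ∫ u in (0 : ℝ)..(2 * Real.pi), turn x y (u, s) =
      ∫ u in (0 : ℝ)..(2 * Real.pi), turn x y (u, t) :=
  eq_of_hasDerivAt_zero (f := fun t => ∫ u in (0 : ℝ)..(2 * Real.pi), turn x y (u, t)) hI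
    (continuousOn_integral (H.smooth_turn (uniqueDiffOn_convex hI hne)).continuousOn)
    (fun _ hr => (H.mono interior_subset).hasDerivAt_total_turn isOpen_interior hr) hs ht

/-! ### Length, area and curvature integrals along the flow -/

namespace CoordFlow

variable {x y : ℝ × ℝ → ℝ} {I : Set ℝ} {t : ℝ}

lemma uniqueDiffOn (H : CoordFlow I x y) : UniqueDiffOn ℝ I :=
  uniqueDiffOn_convex H.convex H.nonempty

lemma frame (H : CoordFlow I x y) (ht : t ∈ I) :
    ConvexFrame (fun u => x (u, t)) (fun u => y (u, t)) (fun u => unitComp x y x (u, t))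
      (fun u => unitComp x y y (u, t)) (fun u => speed x y (u, t)) (fun u => turn x y (u, t)) :=
  H.toCurveFamily.convexFrame H.uniqueDiffOn ht (H.turn_pos t ht) (H.total t ht)

lemma interior_family (H : CoordFlow I x y) : CurveFamily (interior I) x y :=
  H.toCurveFamily.mono interior_subset

lemma integral_support (H : CurveFamily I x y) (ht : t ∈ I) :
    ∫ u in (0 : ℝ)..(2 * Real.pi), support (fun u => x (u, t)) (fun u => y (u, t))
      (fun u => unitComp x y x (u, t)) (fun u => unitComp x y y (u, t)) 0 0 u *
        speed x y (u, t) = 2 * flowArea x y t := by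
  rw [flowArea, ← mul_assoc, mul_one_div_cancel two_ne_zero, one_mul]
  congr 1
  ext u
  rw [CurveFamily.areaForm, ← H.speed_mul_unitComp ht x, ← H.speed_mul_unitComp ht y]
  simp only [support]
  ring

lemma length_pos (H : CoordFlow I x y) (ht : t ∈ I) : 0 < flowLength x y t :=
  intervalIntegral.intervalIntegral_pos_of_pos ((H.frame ht).g_cont.intervalIntegrable _ _)
    (H.frame ht).g_pos Real.two_pi_pos

lemma isoperimetric (H : CoordFlow I x y) (ht : t ∈ I) :
    4 * Real.pi * flowArea x y t ≤ flowLength x y t ^ 2 :=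
  (H.frame ht).isoperimetric_inequality (integral_support H.toCurveFamily ht)

lemma continuousOn_length (H : CoordFlow I x y) : ContinuousOn (flowLength x y) I :=
  continuousOn_integral (H.smooth_speed H.uniqueDiffOn).continuousOn

lemma continuousOn_steiner (H : CoordFlow I x y) {f : ℝ × ℝ → ℝ}
    (hf : ContDiffOn ℝ ∞ f (univ ×ˢ I)) : ContinuousOn (flowSteiner x y f) I :=
  continuousOn_integral (H.smooth_steinerForm H.uniqueDiffOn hf).continuousOn

/-- The total squared curvature. -/
noncomputable def energy (x y : ℝ × ℝ → ℝ) (t : ℝ) : ℝ :=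
  ∫ u in (0 : ℝ)..(2 * Real.pi), turn x y (u, t) ^ 2 / speed x y (u, t)

/-- The integral of the radius of curvature. -/
noncomputable def radiusIntegral (x y : ℝ × ℝ → ℝ) (t : ℝ) : ℝ :=
  ∫ u in (0 : ℝ)..(2 * Real.pi), speed x y (u, t) ^ 2 / turn x y (u, t)

lemma continuous_energy (H : CoordFlow I x y) (ht : t ∈ I) :
    Continuous fun u => turn x y (u, t) ^ 2 / speed x y (u, t) :=
  ((H.frame ht).w_cont.pow 2).div (H.frame ht).g_cont fun u => ((H.frame ht).g_pos u).ne'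

lemma continuous_radius (H : CoordFlow I x y) (ht : t ∈ I) :
    Continuous fun u => speed x y (u, t) ^ 2 / turn x y (u, t) :=
  ((H.frame ht).g_cont.pow 2).div (H.frame ht).w_cont fun u => ((H.frame ht).w_pos u).ne'

lemma radiusIntegral_pos (H : CoordFlow I x y) (ht : t ∈ I) : 0 < radiusIntegral x y t := by
  have F := H.frame ht
  exact intervalIntegral.intervalIntegral_pos_of_pos
    ((H.continuous_radius ht).intervalIntegrable _ _)
    (fun u => div_pos (pow_pos (F.g_pos u) 2) (F.w_pos u)) Real.two_pi_pos

/-- This is `L' = λ L - ∮ κ² ds`, the first variation with `F = κ - λ/κ` inserted. -/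
lemma hasDerivAt_length (H : CoordFlow I x y) (ht : t ∈ interior I) :
    HasDerivAt (flowLength x y) (2 * Real.pi / radiusIntegral x y t * flowLength x y t -
      energy x y t) t := by
  have F := H.frame (interior_subset ht)
  refine (H.interior_family.hasDerivAt_length isOpen_interior ht).congr_deriv ?_
  rw [flowLength, energy, ← intervalIntegral.integral_const_mul,
    ← intervalIntegral.integral_sub ((F.g_cont.const_mul _).intervalIntegrable _ _)
    ((H.continuous_energy (interior_subset ht)).intervalIntegrable _ _)]
  congr 1
  ext u
  rw [H.normal_speed t ht u, ← radiusIntegral]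
  have h1 := (F.g_pos u).ne'
  have h2 := (F.w_pos u).ne'
  field_simp
  ring

/-- The area is preserved. -/
lemma area_eq (H : CoordFlow I x y) {s : ℝ} (hs : s ∈ I) (ht : t ∈ I) :
    flowArea x y s = flowArea x y t := by
  have h := eq_of_hasDerivAt_zero
    (f := fun t => ∫ u in (0 : ℝ)..(2 * Real.pi), CurveFamily.areaForm x y (u, t)) H.convex
    (continuousOn_integral (H.smooth_areaForm H.uniqueDiffOn).continuousOn)
    (fun t ht => ?_) hs ht
  · rw [flowArea, flowArea, h]
  · have F := H.frame (interior_subset ht)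
    refine (H.interior_family.hasDerivAt_area isOpen_interior ht).congr_deriv ?_
    -- The integral of `F ds` is `2π - λ ∮ κ⁻¹ ds`, which is zero by the choice of `λ`.
    have h1 : ∫ u in (0 : ℝ)..(2 * Real.pi), -2 * (speed x y (u, t) *
        CurveFamily.normalSpeed x y (u, t)) = -2 * ((∫ u in (0 : ℝ)..(2 * Real.pi),
          turn x y (u, t)) - 2 * Real.pi / radiusIntegral x y t * radiusIntegral x y t) := by
      nth_rewrite 2 [radiusIntegral]
      rw [← intervalIntegral.integral_const_mul, ← intervalIntegral.integral_sub
        (F.w_cont.intervalIntegrable _ _)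
        (((H.continuous_radius (interior_subset ht)).const_mul _).intervalIntegrable _ _),
        ← intervalIntegral.integral_const_mul]
      congr 1
      ext u
      rw [H.normal_speed t ht u, ← radiusIntegral]
      have h1 := (F.g_pos u).ne'
      have h2 := (F.w_pos u).ne'
      field_simp
    rw [h1, H.total t (interior_subset ht),
      div_mul_cancel₀ _ (H.radiusIntegral_pos (interior_subset ht)).ne', sub_self, mul_zero]

/-- Gage's inequality bounds `∮ κ² ds` from below and the Green–Osher inequality bounds `λ` from
above. The result is the stated bound multiplied by `L² / (L² - 2πA) ≥ 1`, a factor that can be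
dropped because the deficit is nonnegative. -/
lemma length_deriv_le (H : CoordFlow I x y) (ht : t ∈ I) (hA : 0 < flowArea x y t) :
    2 * flowLength x y t *
      (2 * Real.pi / radiusIntegral x y t * flowLength x y t - energy x y t) ≤
      -(2 * Real.pi / flowArea x y t) *
        (flowLength x y t ^ 2 - 4 * Real.pi * flowArea x y t) := by
  have hL := H.length_pos ht
  have h1 : Real.pi * flowLength x y t / flowArea x y t ≤ energy x y t :=
    (H.frame ht).gage_inequality (integral_support H.toCurveFamily ht) hA
  have h2 : (flowLength x y t ^ 2 - 2 * Real.pi * flowArea x y t) / Real.pi ≤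
      radiusIntegral x y t :=
    (H.frame ht).greenOsher_inequality (integral_support H.toCurveFamily ht)
  have h3 := H.isoperimetric ht
  set L := flowLength x y t
  set A := flowArea x y t
  have hπ := Real.pi_pos
  have hM : 0 < L ^ 2 - 2 * Real.pi * A := by nlinarith [mul_pos hπ hA]
  have h4 : 2 * Real.pi / radiusIntegral x y t ≤
      2 * Real.pi / ((L ^ 2 - 2 * Real.pi * A) / Real.pi) :=
    div_le_div_of_nonneg_left (by positivity) (div_pos hM hπ) h2
  have h5 : 2 * L * (2 * Real.pi / radiusIntegral x y t * L - energy x y t) ≤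
      2 * L * (2 * Real.pi / ((L ^ 2 - 2 * Real.pi * A) / Real.pi) * L - Real.pi * L / A) := by
    gcongr
  refine h5.trans ?_
  have h6 : 2 * L * (2 * Real.pi / ((L ^ 2 - 2 * Real.pi * A) / Real.pi) * L - Real.pi * L / A) =
      -(2 * Real.pi / A) * (L ^ 2 - 4 * Real.pi * A) * (L ^ 2 / (L ^ 2 - 2 * Real.pi * A)) := by
    have := hM.ne'
    field_simp
    ring
  rw [h6]
  have h7 : 1 ≤ L ^ 2 / (L ^ 2 - 2 * Real.pi * A) := by
    rw [one_le_div hM]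
    nlinarith [mul_pos hπ hA]
  have h8 : 0 ≤ 2 * Real.pi / A * (L ^ 2 - 4 * Real.pi * A) :=
    mul_nonneg (by positivity) (by linarith)
  nlinarith

/-- Equivalent to `λ L ≤ 4π² / L`. The isoperimetric inequality turns the Green–Osher bound into `∮
κ⁻¹ ds ≥ L² / (2π)`. The left-hand side is `∮ (κ - 2π/L)² ds`, which controls the speed of the
Steiner point. -/
lemma energy_sub_le (H : CoordFlow I x y) (ht : t ∈ I) :
    energy x y t - 4 * Real.pi ^ 2 / flowLength x y t ≤
      -(2 * Real.pi / radiusIntegral x y t * flowLength x y t - energy x y t) := by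
  have hL := H.length_pos ht
  have h2 : (flowLength x y t ^ 2 - 2 * Real.pi * flowArea x y t) / Real.pi ≤
      radiusIntegral x y t :=
    (H.frame ht).greenOsher_inequality (integral_support H.toCurveFamily ht)
  have h3 := H.isoperimetric ht
  set L := flowLength x y t
  set A := flowArea x y t
  have hπ := Real.pi_pos
  have h4 : L ^ 2 / (2 * Real.pi) ≤ radiusIntegral x y t := by
    refine le_trans ?_ h2
    rw [div_le_div_iff₀ (by positivity) hπ]
    nlinarith
  have h5 : 2 * Real.pi / radiusIntegral x y t ≤ 2 * Real.pi / (L ^ 2 / (2 * Real.pi)) :=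
    div_le_div_of_nonneg_left (by positivity) (by positivity) h4
  have h6 : 2 * Real.pi / radiusIntegral x y t * L ≤ 2 * Real.pi / (L ^ 2 / (2 * Real.pi)) * L :=
    mul_le_mul_of_nonneg_right h5 hL.le
  have h7 : 2 * Real.pi / (L ^ 2 / (2 * Real.pi)) * L = 4 * Real.pi ^ 2 / L := by
    field_simp
    ring
  linarith

/-- Exponential decay of the isoperimetric deficit. -/
theorem deficit_decay (H : CoordFlow I x y) {A : ℝ} (hA : ∀ t ∈ I, flowArea x y t = A)
    (hApos : 0 < A) : AntitoneOn (fun t => Real.exp (2 * Real.pi / A * t) *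
      (flowLength x y t ^ 2 - 4 * Real.pi * A)) I := by
  refine antitoneOn_of_hasDerivAt H.convex
    ((by fun_prop : Continuous fun t => Real.exp (2 * Real.pi / A * t)).continuousOn.mul
      ((H.continuousOn_length.pow 2).sub continuousOn_const))
    (fun t ht => (((hasDerivAt_id t).const_mul (2 * Real.pi / A)).exp).mul
      (((H.hasDerivAt_length ht).pow 2).sub_const (4 * Real.pi * A))) fun t ht => ?_
  have ht' := interior_subset ht
  have h1 := H.length_deriv_le ht' (by rw [hA t ht']; exact hApos)
  rw [hA t ht'] at h1
  have h2 := Real.exp_pos (2 * Real.pi / A * t)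
  simp only [id]
  push_cast
  nlinarith

lemma integral_normalSpeed (H : CoordFlow I x y) (ht : t ∈ interior I) (k : ℝ → ℝ) :
    ∫ u in (0 : ℝ)..(2 * Real.pi), CurveFamily.normalSpeed x y (u, t) *
      (turn x y (u, t) * k u) = ∫ u in (0 : ℝ)..(2 * Real.pi),
        (turn x y (u, t) ^ 2 / speed x y (u, t) -
          2 * Real.pi / radiusIntegral x y t * speed x y (u, t)) * k u := by
  have F := H.frame (interior_subset ht)
  congr 1
  ext u
  rw [H.normal_speed t ht u, ← radiusIntegral]
  have h1 := (F.g_pos u).ne'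
  have h2 := (F.w_pos u).ne'
  field_simp

/-- The Steiner point moves at most at a constant times the speed at which the length shrinks. -/
lemma exists_steiner_deriv (H : CoordFlow I x y) (ht : t ∈ interior I) :
    (∃ v, HasDerivAt (flowSteiner x y x) v t ∧ |v| ≤
      -(2 * Real.pi / radiusIntegral x y t * flowLength x y t - energy x y t)) ∧
    ∃ v, HasDerivAt (flowSteiner x y y) v t ∧ |v| ≤
      -(2 * Real.pi / radiusIntegral x y t * flowLength x y t - energy x y t) := by
  have ht' := interior_subset ht
  have F := H.frame ht'
  have hE := H.energy_sub_le ht'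
  constructor
  · refine ⟨_, H.interior_family.hasDerivAt_steiner_x isOpen_interior ht, ?_⟩
    refine le_trans (le_of_eq ?_) ((F.abs_integral_curvature_le F.b_cont F.abs_b_le
      F.integral_g_b F.integral_w_b (2 * Real.pi / radiusIntegral x y t)).trans hE)
    rw [← H.integral_normalSpeed ht]
    congr 2
    ext u
    rw [H.du_a H.uniqueDiffOn ht']
    ring
  · refine ⟨_, H.interior_family.hasDerivAt_steiner_y isOpen_interior ht, ?_⟩
    refine le_trans (le_of_eq ?_) ((F.abs_integral_curvature_le F.a_cont F.abs_a_le
      F.integral_g_a F.integral_w_a (2 * Real.pi / radiusIntegral x y t)).trans hE)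
    rw [← H.integral_normalSpeed ht, intervalIntegral.integral_neg, abs_neg]
    congr 2
    ext u
    rw [H.du_b H.uniqueDiffOn ht']

lemma tendsto_of_monotoneOn_of_bddAbove {f : ℝ → ℝ} {C : ℝ} (hf : MonotoneOn f (Ici 0))
    (hC : ∀ t, 0 ≤ t → f t ≤ C) : ∃ l, Tendsto f atTop (𝓝 l) := by
  -- Freezing `f` at negative times gives a function that is monotone on the whole line and has the
  -- same limit.
  have hm : Monotone fun t => f (max t 0) := fun s t hst =>
    hf (mem_Ici.2 (le_max_right _ _)) (mem_Ici.2 (le_max_right _ _)) (max_le_max_right 0 hst)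
  refine ⟨_, (tendsto_atTop_ciSup hm ⟨C, ?_⟩).congr' ?_⟩
  · rintro _ ⟨t, rfl⟩
    exact hC _ (le_max_right _ _)
  · filter_upwards [eventually_ge_atTop 0] with t ht
    rw [max_eq_left ht]

/-- A function which moves at most as fast as a convergent antitone function converges. -/
lemma exists_tendsto_of_abs_deriv_le {f L L' : ℝ → ℝ} {l : ℝ} (hf : ContinuousOn f (Ici 0))
    (hL : ContinuousOn L (Ici 0)) (hLd : ∀ t ∈ interior (Ici (0 : ℝ)), HasDerivAt L (L' t) t)
    (hfd : ∀ t ∈ interior (Ici (0 : ℝ)), ∃ v, HasDerivAt f v t ∧ |v| ≤ -L' t)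
    (hL0 : ∀ t, 0 ≤ t → 0 ≤ L t) (hl : Tendsto L atTop (𝓝 l)) :
    ∃ c, Tendsto f atTop (𝓝 c) := by
  choose! v hv hv' using hfd
  -- `f - L` is nondecreasing and `f + L` is nonincreasing. As `L ≥ 0`, the former is bounded by `f
  -- + L`, hence by `f 0 + L 0`.
  have h1 : MonotoneOn (fun t => f t - L t) (Ici 0) :=
    monotoneOn_of_hasDerivAt (convex_Ici 0) (hf.sub hL)
      (fun t ht => (hv t ht).sub (hLd t ht)) fun t ht => by
        have := neg_le_of_abs_le (hv' t ht)
        linarith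
  have h2 : AntitoneOn (fun t => f t + L t) (Ici 0) :=
    antitoneOn_of_hasDerivAt (convex_Ici 0) (hf.add hL)
      (fun t ht => (hv t ht).add (hLd t ht)) fun t ht => by
        have := le_of_abs_le (hv' t ht)
        linarith
  obtain ⟨c, hc⟩ := tendsto_of_monotoneOn_of_bddAbove (C := f 0 + L 0) h1 fun t ht => by
    have h3 := h2 self_mem_Ici ht ht
    have h4 := hL0 t ht
    simp only at h3
    linarith
  exact ⟨c + l, (hc.add hl).congr fun t => sub_add_cancel _ _⟩

/-- The circle-closeness of the curve at time `t` around any point near the Steiner point. -/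
lemma support_close (H : CoordFlow I x y) (ht : t ∈ I) (hA : 0 < flowArea x y t) (p r : ℝ)
    (u : ℝ) :
    |support (fun u => x (u, t)) (fun u => y (u, t)) (fun u => unitComp x y x (u, t))
      (fun u => unitComp x y y (u, t)) p r u - √(flowArea x y t / Real.pi)| ≤
      5 * √(flowLength x y t ^ 2 - 4 * Real.pi * flowArea x y t) +
        |-(1 / Real.pi) * flowSteiner x y x t - p| +
        |-(1 / Real.pi) * flowSteiner x y y t - r| := by
  have F := H.frame ht
  obtain ⟨p', r', h⟩ := F.exists_center (integral_support H.toCurveFamily ht) hA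
  obtain ⟨h1, h2⟩ := F.steiner_close h
  have e1 : 1 / Real.pi * (∫ u in (0 : ℝ)..(2 * Real.pi), support (fun u => x (u, t))
      (fun u => y (u, t)) (fun u => unitComp x y x (u, t))
      (fun u => unitComp x y y (u, t)) 0 0 u * (turn x y (u, t) * unitComp x y y (u, t))) =
      -(1 / Real.pi) * flowSteiner x y x t := by
    rw [neg_mul, ← mul_neg, flowSteiner, ← intervalIntegral.integral_neg]
    congr 2
    ext u
    rw [CurveFamily.steinerForm, H.du_a H.uniqueDiffOn ht]
    simp only [support]
    ring
  have e2 : (∫ u in (0 : ℝ)..(2 * Real.pi), support (fun u => x (u, t))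
      (fun u => y (u, t)) (fun u => unitComp x y x (u, t))
      (fun u => unitComp x y y (u, t)) 0 0 u * (turn x y (u, t) * unitComp x y x (u, t))) =
      flowSteiner x y y t := by
    rw [flowSteiner]
    congr 1
    ext u
    rw [CurveFamily.steinerForm, H.du_b H.uniqueDiffOn ht]
    simp only [support]
    ring
  rw [e1] at h1
  rw [e2] at h2
  change ∀ u, _ ≤ √(flowLength x y t ^ 2 - 4 * Real.pi * flowArea x y t) at h
  change _ ≤ 2 * √(flowLength x y t ^ 2 - 4 * Real.pi * flowArea x y t) at h1
  change _ ≤ 2 * √(flowLength x y t ^ 2 - 4 * Real.pi * flowArea x y t) at h2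
  set δ := √(flowLength x y t ^ 2 - 4 * Real.pi * flowArea x y t)
  set E := -(1 / Real.pi) * flowSteiner x y x t
  set G := -(1 / Real.pi) * flowSteiner x y y t
  -- The origin moves from the Bonnesen centre `(p', r')` to `(p, r)` by way of the Steiner point
  -- `(E, G)`. The constant `5` is `1` for the deviation about the centre and `2` for each
  -- coordinate of its distance to the Steiner point.
  have e3 : support (fun u => x (u, t)) (fun u => y (u, t)) (fun u => unitComp x y x (u, t))
      (fun u => unitComp x y y (u, t)) p r u - √(flowArea x y t / Real.pi) =
      (support (fun u => x (u, t)) (fun u => y (u, t)) (fun u => unitComp x y x (u, t))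
      (fun u => unitComp x y y (u, t)) p' r' u - √(flowArea x y t / Real.pi)) +
      (((E - p) - (E - p')) * unitComp x y y (u, t) -
        ((G - r) - (G - r')) * unitComp x y x (u, t)) := by
    simp only [support]
    ring
  have ha := F.abs_a_le u
  have hb := F.abs_b_le u
  have b1 : |((E - p) - (E - p')) * unitComp x y y (u, t)| ≤ |E - p| + 2 * δ := by
    rw [abs_mul]
    refine (mul_le_of_le_one_right (abs_nonneg _) hb).trans ((abs_sub _ _).trans ?_)
    linarith
  have b2 : |((G - r) - (G - r')) * unitComp x y x (u, t)| ≤ |G - r| + 2 * δ := by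
    rw [abs_mul]
    refine (mul_le_of_le_one_right (abs_nonneg _) ha).trans ((abs_sub _ _).trans ?_)
    linarith
  rw [e3]
  refine (abs_add_le _ _).trans ?_
  have b3 := abs_sub (((E - p) - (E - p')) * unitComp x y y (u, t))
    (((G - r) - (G - r')) * unitComp x y x (u, t))
  have b4 := h u
  linarith

end CoordFlow

end CurveFlow

namespace CurveFlow

/-! ### From the flow to its coordinates -/

section Flow

variable {T : EReal} {X : ℝ → ℝ → Plane}

lemma IsFlow.curveFamily (hX : IsFlow T X) :
    CurveFamily (timeInterval T) (coord X 0) (coord X 1) where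
  smooth_x := contDiffOn_coord hX.smooth 0
  smooth_y := contDiffOn_coord hX.smooth 1
  per_x t ht u := congrArg (fun v : Plane => v 0) (hX.periodic t ht u)
  per_y t ht u := congrArg (fun v : Plane => v 1) (hX.periodic t ht u)
  regular t ht u := by
    have h := norm_pos_iff.2 (hX.regular t ht u)
    rw [norm_plane, Real.sqrt_pos, deriv_slice_apply hX.smooth ht,
      deriv_slice_apply hX.smooth ht] at h
    exact h

/-- Pairing the evolution equation with the normal removes `η`. At interior times the one-sided
derivative of the flow is a genuine derivative. -/
lemma IsFlow.normalSpeed_eq (hX : IsFlow T X) {t : ℝ}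
    (ht : t ∈ interior (timeInterval T)) (u : ℝ) :
    CurveFamily.normalSpeed (coord X 0) (coord X 1) (u, t) =
      curvature (fun v => X v t) u -
        nonlocalTerm (fun v => X v t) / curvature (fun v => X v t) u := by
  obtain ⟨η, hη⟩ := hX.evolution
  have ht' := interior_subset ht
  have h := (hη t ht' u).hasDerivAt (mem_interior_iff_mem_nhds.1 ht)
  set F := curvature (fun v => X v t) u -
    nonlocalTerm (fun v => X v t) / curvature (fun v => X v t) u
  have h0 : dt (coord X 0) (u, t) = _ := (HasDerivAt.plane_apply h 0).deriv
  have h1 : dt (coord X 1) (u, t) = _ := (HasDerivAt.plane_apply h 1).deriv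
  have hu := hX.curveFamily.unit ht' u
  simp only [PiLp.add_apply, PiLp.smul_apply, smul_eq_mul, tangent_slice hX.smooth ht',
    (normal_slice hX.smooth ht' u).1, (normal_slice hX.smooth ht' u).2] at h0 h1
  rw [CurveFamily.normalSpeed, h0, h1]
  linear_combination F * hu

/-- At fixed `u` the curvature is continuous in time, positive at the start and never zero. -/
lemma IsFlow.turn_pos (hT : 0 < T) (hX : IsFlow T X)
    (hX₀ : IsStrictlyConvexClosed (fun u => X u 0)) {t : ℝ} (ht : t ∈ timeInterval T) (u : ℝ) :
    0 < turn (coord X 0) (coord X 1) (u, t) := by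
  have hU := uniqueDiffOn_timeInterval hT
  have H := hX.curveFamily
  have h0 : 0 < turn (coord X 0) (coord X 1) (u, 0) := by
    have h := hX₀.curvature_pos u
    rw [curvature_slice hX.smooth H hU (zero_mem_timeInterval hT)] at h
    exact (div_pos_iff_of_pos_right (H.speed_pos (zero_mem_timeInterval hT) u)).1 h
  by_contra! hle
  have hc : ContinuousOn (fun t => turn (coord X 0) (coord X 1) (u, t)) (timeInterval T) :=
    (H.smooth_turn hU).continuousOn.comp (by fun_prop) fun s hs => ⟨mem_univ _, hs⟩
  obtain ⟨s, hs, hs0⟩ := (convex_timeInterval T).isPreconnected.intermediate_value ht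
    (zero_mem_timeInterval hT) hc ⟨hle, h0.le⟩
  apply hX.curvature_ne_zero s hs u
  simp only at hs0
  rw [curvature_slice hX.smooth H hU hs, hs0, zero_div]

lemma support_slice_nonneg (hT : 0 < T) (hX : IsFlow T X)
    (hX₀ : IsStrictlyConvexClosed (fun u => X u 0)) (u v : ℝ) :
    0 ≤ support (fun u => coord X 0 (u, 0)) (fun u => coord X 1 (u, 0))
      (fun u => unitComp (coord X 0) (coord X 1) (coord X 0) (u, 0))
      (fun u => unitComp (coord X 0) (coord X 1) (coord X 1) (u, 0))
      (coord X 0 (v, 0)) (coord X 1 (v, 0)) u := by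
  have h := hX₀.convex u v
  rw [inner_plane, (normal_slice hX.smooth (zero_mem_timeInterval hT) u).1,
    (normal_slice hX.smooth (zero_mem_timeInterval hT) u).2, PiLp.sub_apply, PiLp.sub_apply] at h
  simp only [support, coord] at h ⊢
  linarith

lemma simple_slice (hX₀ : IsStrictlyConvexClosed (fun u => X u 0)) :
    ∀ u ∈ Ioo 0 (2 * Real.pi),
      ¬(coord X 0 (u, 0) = coord X 0 (0, 0) ∧ coord X 1 (u, 0) = coord X 1 (0, 0)) := by
  rintro u hu ⟨h0, h1⟩
  have : X u 0 = X 0 0 := by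
    ext i
    fin_cases i
    · exact h0
    · exact h1
  exact hu.1.ne' (hX₀.simple (Ioo_subset_Ico_self hu) ⟨le_rfl, Real.two_pi_pos⟩ this)

lemma IsFlow.coordFlow (hT : 0 < T) (hX : IsFlow T X)
    (hX₀ : IsStrictlyConvexClosed (fun u => X u 0)) :
    CoordFlow (timeInterval T) (coord X 0) (coord X 1) where
  toCurveFamily := hX.curveFamily
  convex := convex_timeInterval T
  nonempty := interior_timeInterval_nonempty hT
  turn_pos _ ht u := hX.turn_pos hT hX₀ ht u
  total t ht := by
    have h0 := zero_mem_timeInterval hT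
    have hU := uniqueDiffOn_timeInterval hT
    have H := hX.curveFamily
    -- Simplicity and convexity are known at time `0` only, so the turning number is computed there
    -- and carried to time `t`.
    rw [H.total_turn_eq (convex_timeInterval T) (interior_timeInterval_nonempty hT) ht h0]
    have ha := H.per_a h0 0
    have hb := H.per_b h0 0
    rw [zero_add] at ha hb
    exact total_turn_of_simple (H.deriv_x h0) (H.deriv_y h0) (H.deriv_a hU h0) (H.deriv_b hU h0)
      (H.unit h0) (hX.turn_pos hT hX₀ h0) (continuous_slice (H.smooth_turn hU).continuousOn h0)
      (support_slice_nonneg hT hX hX₀) (simple_slice hX₀) ha hb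
  normal_speed t ht u := by
    have hU := uniqueDiffOn_timeInterval hT
    have H := hX.curveFamily
    rw [hX.normalSpeed_eq ht, curvature_slice hX.smooth H hU (interior_subset ht),
      nonlocalTerm_slice hX.smooth H hU (interior_subset ht), div_div_eq_mul_div, mul_div_assoc]

lemma IsFlow.area_pos (hT : 0 < T) (hX : IsFlow T X)
    (hX₀ : IsStrictlyConvexClosed (fun u => X u 0)) :
    0 < flowArea (coord X 0) (coord X 1) 0 := by
  have h0 := zero_mem_timeInterval hT
  have hU := uniqueDiffOn_timeInterval hT
  have H := hX.curveFamily
  have h := area_pos_of_simple (H.deriv_x h0) (H.deriv_y h0) (H.deriv_a hU h0) (H.deriv_b hU h0)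
    (H.unit h0) (hX.turn_pos hT hX₀ h0) (H.speed_pos h0)
    (continuous_slice (H.smooth_speed hU).continuousOn h0)
    (support_slice_nonneg hT hX hX₀) (simple_slice hX₀)
  have hp := H.per_x 0 h0 0
  have hq := H.per_y 0 h0 0
  simp only [zero_add] at hp hq
  -- Positivity is known for the origin placed at a point of the curve; on a closed curve the
  -- integral does not depend on the origin.
  rw [((hX.coordFlow hT hX₀).frame h0).integral_support_translate,
    CoordFlow.integral_support H h0, hp, hq] at h
  linarith

end Flow

/-! ### Convergence to a circle -/

lemma dist_plane_sq (v w : Plane) : dist v w ^ 2 = (v 0 - w 0) ^ 2 + (v 1 - w 1) ^ 2 := by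
  rw [dist_eq_norm, norm_plane, Real.sq_sqrt (by positivity), PiLp.sub_apply, PiLp.sub_apply]

/-- A curve whose support function is almost constant is Hausdorff close to a circle. -/
lemma hausdorffDist_circle_le {γ : ℝ → Plane} {a b g w : ℝ → ℝ}
    (H : ConvexFrame (fun u => γ u 0) (fun u => γ u 1) a b g w) {c : Plane} {R ε : ℝ} (hR : 0 < R)
    (h : ∀ u, |support (fun u => γ u 0) (fun u => γ u 1) a b (c 0) (c 1) u - R| ≤ ε) :
    Metric.hausdorffDist (range γ) (Metric.sphere c R) ≤ √(4 * R * ε + ε ^ 2) := by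
  have key : ∀ (u : ℝ) (z : Plane), z 0 = c 0 + R * b u → z 1 = c 1 - R * a u →
      dist (γ u) z ≤ √(4 * R * ε + ε ^ 2) := by
    intro u z h0 h1
    apply Real.le_sqrt_of_sq_le
    rw [dist_plane_sq, h0, h1]
    exact H.dist_sq_circle_le hR.le h u
  refine Metric.hausdorffDist_le_of_mem_dist (Real.sqrt_nonneg _) ?_ ?_
  · rintro _ ⟨u, rfl⟩
    refine ⟨!₂[c 0 + R * b u, c 1 - R * a u], ?_, key u _ (by simp) (by simp)⟩
    rw [Metric.mem_sphere, ← sq_eq_sq₀ dist_nonneg hR.le, dist_plane_sq]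
    simp only [Matrix.cons_val_zero, Matrix.cons_val_one]
    linear_combination R ^ 2 * H.unit u
  · intro z hz
    rw [Metric.mem_sphere, ← sq_eq_sq₀ dist_nonneg hR.le, dist_plane_sq] at hz
    -- The parameter is chosen so that the outer normal `(b, -a)` of the curve is `(z - c) / R`.
    obtain ⟨u, ha, hb⟩ := H.exists_tangent_eq (s := -(z 1 - c 1) / R) (t := (z 0 - c 0) / R) (by
      field_simp
      linarith)
    refine ⟨γ u, mem_range_self u, ?_⟩
    rw [dist_comm]
    refine key u z ?_ ?_
    · rw [hb]
      field_simp
      ring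
    · rw [ha]
      field_simp
      ring

end CurveFlow

/-! ### Monotonicity, decay and convergence of the flow -/

theorem mainTheorem5 (T : EReal) (hT : 0 < T) (X : ℝ → ℝ → CurveFlow.Plane)
    (hX : CurveFlow.IsFlow T X)
    (hX₀ : CurveFlow.IsStrictlyConvexClosed (fun u => X u 0)) :
    -- the deficit decreases, strictly as long as it is positive
    AntitoneOn (fun t => CurveFlow.deficit (fun u => X u t)) (CurveFlow.timeInterval T) ∧
    (∀ s ∈ CurveFlow.timeInterval T, ∀ t ∈ CurveFlow.timeInterval T, s < t →
      0 < CurveFlow.deficit (fun u => X u s) →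
      CurveFlow.deficit (fun u => X u t) < CurveFlow.deficit (fun u => X u s)) ∧
    -- it is nonnegative and decays exponentially
    0 < CurveFlow.area (fun u => X u 0) ∧
    (∀ t ∈ CurveFlow.timeInterval T,
      0 ≤ CurveFlow.deficit (fun u => X u t) ∧
      CurveFlow.deficit (fun u => X u t) ≤ CurveFlow.deficit (fun u => X u 0) *
        Real.exp (-(2 * Real.pi * t / CurveFlow.area (fun u => X u 0))) ∧
      (1 / 2 ≤ CurveFlow.length (fun u => X u 0) →
        CurveFlow.deficit (fun u => X u t) ≤ CurveFlow.deficit (fun u => X u 0) *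
          Real.exp (-(Real.pi * t /
            (CurveFlow.area (fun u => X u 0) * CurveFlow.length (fun u => X u 0)))))) ∧
    -- if the flow exists for all times, the deficit tends to zero and the curves converge
    (T = ⊤ →
      Tendsto (fun t => CurveFlow.deficit (fun u => X u t)) atTop (𝓝 0) ∧
      ∃ c : CurveFlow.Plane,
        Tendsto (fun t => Metric.hausdorffDist (range (fun u => X u t))
            (Metric.sphere c (Real.sqrt (CurveFlow.area (fun u => X u 0) / Real.pi))))
          atTop (𝓝 0)) := by
  open CurveFlow in
  have h0 := zero_mem_timeInterval hT
  have H := hX.coordFlow hT hX₀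
  have hA0 := hX.area_pos hT hX₀
  set A := flowArea (coord X 0) (coord X 1) 0 with hAdef
  have hA : ∀ t ∈ timeInterval T, flowArea (coord X 0) (coord X 1) t = A := fun t ht =>
    H.area_eq ht h0
  have hApos : ∀ t ∈ timeInterval T, 0 < flowArea (coord X 0) (coord X 1) t := fun t ht => by
    rw [hA t ht]; exact hA0
  have harea : area (fun u => X u 0) = A := area_slice hX.smooth h0
  have hdef : ∀ t ∈ timeInterval T, deficit (fun u => X u t) =
      flowLength (coord X 0) (coord X 1) t ^ 2 - 4 * Real.pi * A := fun t ht => by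
    have h1 : area (fun u => X u t) = flowArea (coord X 0) (coord X 1) t :=
      area_slice hX.smooth ht
    rw [deficit, h1, hA t ht, length_slice hX.smooth ht]
    rfl
  have hnonneg : ∀ t ∈ timeInterval T, 0 ≤ deficit (fun u => X u t) := fun t ht => by
    have := H.isoperimetric ht
    rw [hA t ht] at this
    rw [hdef t ht]
    linarith
  have hdecay : ∀ s ∈ timeInterval T, ∀ t ∈ timeInterval T, s ≤ t →
      deficit (fun u => X u t) ≤ deficit (fun u => X u s) *
        Real.exp (-(2 * Real.pi / A * (t - s))) := fun s hs t ht hst => by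
    have h1 := H.deficit_decay hA hA0 hs ht hst
    simp only [← hdef s hs, ← hdef t ht] at h1
    rw [show -(2 * Real.pi / A * (t - s)) = 2 * Real.pi / A * s - 2 * Real.pi / A * t by ring,
      Real.exp_sub, mul_div_assoc', le_div_iff₀ (Real.exp_pos _)]
    linarith
  have hrate : 0 < 2 * Real.pi / A := div_pos Real.two_pi_pos hA0
  have hexp : ∀ t ∈ timeInterval T, deficit (fun u => X u t) ≤ deficit (fun u => X u 0) *
      Real.exp (-(2 * Real.pi * t / A)) := fun t ht => by
    have h1 := hdecay 0 h0 t ht ht.1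
    rwa [sub_zero, div_mul_eq_mul_div] at h1
  refine ⟨fun s hs t ht hst => ?_, fun s hs t ht hst hpos => ?_, by rw [harea]; exact hA0,
    fun t ht => ⟨hnonneg t ht, by rw [harea]; exact hexp t ht, fun hL => ?_⟩, fun hTtop => ?_⟩
  · refine (hdecay s hs t ht hst).trans (mul_le_of_le_one_right (hnonneg s hs) ?_)
    exact Real.exp_le_one_iff.2 (neg_nonpos.2 (mul_nonneg hrate.le (sub_nonneg.2 hst)))
  · refine (hdecay s hs t ht hst.le).trans_lt (mul_lt_of_lt_one_right hpos ?_)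
    exact Real.exp_lt_one_iff.2 (neg_neg_of_pos (mul_pos hrate (sub_pos.2 hst)))
  · refine (hexp t ht).trans (mul_le_mul_of_nonneg_left ?_ (hnonneg 0 h0))
    rw [harea]
    refine Real.exp_le_exp.2 (neg_le_neg ?_)
    have hLpos : 0 < length (fun u => X u 0) := by linarith
    -- The weaker rate `π / (A L)` is at most `2π / A` exactly when `L ≥ 1/2`.
    rw [div_le_div_iff₀ (mul_pos hA0 hLpos) hA0]
    have := mul_nonneg (mul_nonneg Real.pi_pos.le ht.1) hA0.le
    nlinarith
  · subst hTtop
    rw [timeInterval_top] at *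
    have hlim : Tendsto (fun t => deficit (fun u => X u t)) atTop (𝓝 0) := by
      have h1 : Tendsto (fun t : ℝ => deficit (fun u => X u 0) *
          Real.exp (-(2 * Real.pi * t / A))) atTop (𝓝 0) := by
        have h2 := (Real.tendsto_exp_neg_atTop_nhds_zero.comp
          (tendsto_id.const_mul_atTop hrate)).const_mul (deficit fun u => X u 0)
        rw [mul_zero] at h2
        refine h2.congr fun t => ?_
        rw [Function.comp_apply, id, div_mul_eq_mul_div]
      refine tendsto_of_tendsto_of_tendsto_of_le_of_le' tendsto_const_nhds h1 ?_ ?_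
      · filter_upwards [eventually_ge_atTop 0] with t ht using hnonneg t ht
      · filter_upwards [eventually_ge_atTop 0] with t ht using hexp t ht
    refine ⟨hlim, ?_⟩
    -- With `A` constant, `L` is the square root of the deficit plus `4πA`.
    have hLlim : Tendsto (flowLength (coord X 0) (coord X 1)) atTop
        (𝓝 (√(0 + 4 * Real.pi * A))) := by
      refine ((hlim.add_const (4 * Real.pi * A)).sqrt).congr' ?_
      filter_upwards [eventually_ge_atTop 0] with t ht
      rw [hdef t ht, sub_add_cancel, Real.sqrt_sq (H.length_pos ht).le]
    obtain ⟨p, hp⟩ := CoordFlow.exists_tendsto_of_abs_deriv_le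
      (H.continuousOn_steiner H.smooth_x) H.continuousOn_length
      (fun t ht => H.hasDerivAt_length ht) (fun t ht => (H.exists_steiner_deriv ht).1)
      (fun t ht => (H.length_pos ht).le) hLlim
    obtain ⟨r, hr⟩ := CoordFlow.exists_tendsto_of_abs_deriv_le
      (H.continuousOn_steiner H.smooth_y) H.continuousOn_length
      (fun t ht => H.hasDerivAt_length ht) (fun t ht => (H.exists_steiner_deriv ht).2)
      (fun t ht => (H.length_pos ht).le) hLlim
    -- The limit of the Steiner points, with the normalizing factor `-1/π` of `flowSteiner`
    -- restored.
    set c : Plane := !₂[-(1 / Real.pi) * p, -(1 / Real.pi) * r] with hc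
    have hc0 : c 0 = -(1 / Real.pi) * p := by simp [hc]
    have hc1 : c 1 = -(1 / Real.pi) * r := by simp [hc]
    refine ⟨c, ?_⟩
    rw [harea]
    set R := √(A / Real.pi) with hR
    have hRpos : 0 < R := Real.sqrt_pos.2 (div_pos hA0 Real.pi_pos)
    -- A bound for `|h - R|` about the fixed centre `c`: the deviation about the moving Steiner
    -- point plus the distance of that point from its limit.
    set ε : ℝ → ℝ := fun t => 5 * √(deficit (fun u => X u t)) +
      |-(1 / Real.pi) * flowSteiner (coord X 0) (coord X 1) (coord X 0) t - c 0| +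
      |-(1 / Real.pi) * flowSteiner (coord X 0) (coord X 1) (coord X 1) t - c 1| with hε
    have hεlim : Tendsto ε atTop (𝓝 0) := by
      have h1 := ((hp.const_mul (-(1 / Real.pi))).sub_const (c 0)).abs
      have h2 := ((hr.const_mul (-(1 / Real.pi))).sub_const (c 1)).abs
      have h3 := ((hlim.sqrt.const_mul 5).add h1).add h2
      have e : 5 * √0 + |-(1 / Real.pi) * p - c 0| + |-(1 / Real.pi) * r - c 1| = 0 := by
        rw [hc0, hc1]
        simp
      rw [e] at h3
      exact h3
    have hbound : Tendsto (fun t => √(4 * R * ε t + ε t ^ 2)) atTop (𝓝 0) := by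
      have := ((hεlim.const_mul (4 * R)).add (hεlim.pow 2)).sqrt
      simpa using this
    refine squeeze_zero' (Filter.Eventually.of_forall fun _ => Metric.hausdorffDist_nonneg) ?_
      hbound
    filter_upwards [eventually_ge_atTop 0] with t ht
    refine hausdorffDist_circle_le (γ := fun u => X u t) (H.frame ht) hRpos fun u => ?_
    have h1 := H.support_close ht (hApos t ht) (c 0) (c 1) u
    rw [hA t ht, ← hdef t ht] at h1
    exact h1
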